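/- Let $\mathbb{T}_\Delta=(V,E)$ denote the infinite $\Delta$-regular tree, let $q\ge 2$ be an integer and write $[q]=\{1,\dots,q\}$. For a finite graph $H=(W,F)$ and $w\in(0,1)$, let $\Pr_{H;q,w}$ be the probability measure on maps $\sigma:W\to[q]$ that gives $\sigma$ probability proportional to $w^{m(\sigma)}$, where $m(\sigma)$ is the number of edges $\{u,v\}\in F$ with $\sigma(u)=\sigma(v)$. For finite $U\subset V$, let $\partial U$ be the set of vertices in $U$ that have a neighbour in $V\setminus U$, let $U^\circ=U\setminus\partial U$, and let $\mathbb{T}_\Delta[U]$ be the subgraph induced by $U$. A Gibbs measure for the $q$-state anti-ferromagnetic Potts model on $\mathbb{T}_\Delta$ with edge interaction parameter $w\in(0,1)$ is a probability measure $\mu$ on $[q]^V$, with the product $\sigma$-algebra, such that for every finite $U\subset V$ and every $\sigma:U\to[q]$, for $\mu$-almost every $\phi\in[q]^V$, $$\Pr_\mu\big[\mathbf\Phi\!\restriction_U=\sigma \,\big|\, \mathbf\Phi\!\restriction_{V\setminus U^\circ}=\phi\!\restriction_{V\setminus U^\circ}\big]=\Pr_{\mathbb{T}_\Delta[U];q,w}\big[\mathbf\Phi\!\restriction_U=\sigma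 \,\big|\, \mathbf\Phi\!\restriction_{\partial U}=\phi\!\restriction_{\partial U}\big],$$ where the left-hand side is the conditional probability given the $\sigma$-algebra generated by the colours of the vertices outside $U^\circ$. **Theorem.** For each integer $q\ge 5$ there exists $\Delta_0\in\mathbb{N}$ such that for each integer $\Delta\ge\Delta_0$ and each $w\in[w_c,1)$, where $w_c=\max\{0,1-q/\Delta\}$, there is exactly one Gibbs measure for the $q$-state anti-ferromagnetic Potts model on $\mathbb{T}_\Delta$ with edge interaction parameter $w$. -/

import Mathlib

open MeasureTheory ProbabilityTheory

noncomputable section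

/-! ## The infinite regular tree -/

/-- Vertices of the `Δ`-regular tree: finite words over an alphabet of `Δ` letters in which no
two consecutive letters are equal.  The empty word is the root. -/
def TreeVertex (Δ : ℕ) : Type := {l : List (Fin Δ) // l.IsChain (· ≠ ·)}

/-- The infinite `Δ`-regular tree (infinite as soon as `2 ≤ Δ`): two words are adjacent if one of
them arises from the other by prepending one letter.  See `regularTree_isTree` and
`regularTree_encard_neighborSet`. -/
def regularTree (Δ : ℕ) : SimpleGraph (TreeVertex Δ) where
  Adj u v := (∃ a, u.1 = a :: v.1) ∨ (∃ a, v.1 = a :: u.1)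
  symm := ⟨fun _ _ h => h.symm⟩
  loopless := ⟨fun u h => by rcases h with ⟨a, h⟩ | ⟨a, h⟩ <;> simp at h⟩

/-! ## The Potts model on a finite graph -/

section Finite

variable {W : Type*} [Fintype W] {q : ℕ}

/-- The number `m(σ)` of edges `{u, v}` with `σ u = σ v`. -/
def monoEdgeCount (H : SimpleGraph W) (σ : W → Fin q) : ℕ :=
  {e : Sym2 W | e ∈ H.edgeSet ∧ (e.map σ).IsDiag}.ncard

open Classical in
/-- The partition function `Z(H; q, w)`. -/
def pottsZ (H : SimpleGraph W) (q : ℕ) (w : ℝ) : ℝ :=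
  ∑ σ : W → Fin q, w ^ monoEdgeCount H σ

open Classical in
/-- The probability `Pr_{H; q, w}[Φ ∈ A]` of an event `A` for the Potts model on a finite graph. -/
def pottsPr (H : SimpleGraph W) (w : ℝ) (A : Set (W → Fin q)) : ℝ :=
  ∑ σ : W → Fin q with σ ∈ A, w ^ monoEdgeCount H σ / pottsZ H q w

/-- The conditional probability `Pr_{H; q, w}[Φ ∈ A | Φ ∈ B]`.  (For `0 < w`, which is the only
case that matters, every nonempty event `B` has positive probability.) -/
def pottsCondPr (H : SimpleGraph W) (w : ℝ) (A B : Set (W → Fin q)) : ℝ :=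
  pottsPr H w (A ∩ B) / pottsPr H w B

end Finite

/-! ## Gibbs measures on an infinite graph -/

section Infinite

variable {V : Type*} {q : ℕ}

/-- `∂U`: the vertices of `U` that have a neighbour outside `U`. -/
def innerBoundary (G : SimpleGraph V) (U : Finset V) : Set V :=
  {v | v ∈ U ∧ ∃ u, u ∉ U ∧ G.Adj v u}

/-- `U° = U \ ∂U`. -/
def graphInterior (G : SimpleGraph V) (U : Finset V) : Set V :=
  (U : Set V) \ innerBoundary G U

/-- `Pr_{G[U]; q, w}[Φ|_U = σ | Φ|_{∂U} = ω|_{∂U}]`, where `G[U]` is the (finite) subgraph of `G`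
induced by `U`. -/
def pottsKernel (G : SimpleGraph V) (w : ℝ) (U : Finset V)
    (σ : ↥(U : Set V) → Fin q) (ω : V → Fin q) : ℝ :=
  pottsCondPr (G.induce (U : Set V)) w {σ}
    {τ | ∀ v : (U : Set V), v.1 ∈ innerBoundary G U → τ v = ω v.1}

/-- `μ` is a Gibbs measure of the `q`-state Potts model on `G` with edge interaction parameter `w`:
it is a probability measure on the configurations `V → [q]` (with the product sigma algebra), and
for every finite `U` and every colouring `σ` of `U`, the conditional probability of the event
`Φ|_U = σ` given the restriction of `Φ` to `V \ U°` is almost surely the one in the finite graph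
`G[U]` with boundary condition `Φ|_{∂U}`.  The sigma algebra generated by the coordinates in a
set `S` of vertices is `cylinderEvents S`. -/
structure IsPottsGibbs (G : SimpleGraph V) (q : ℕ) (w : ℝ) (μ : Measure (V → Fin q)) : Prop where
  isProbabilityMeasure : IsProbabilityMeasure μ
  condProb_eq : ∀ (U : Finset V) (σ : ↥(U : Set V) → Fin q),
    μ⟦{ω : V → Fin q | ∀ v : (U : Set V), ω v.1 = σ v} |
        cylinderEvents (X := fun _ : V => Fin q) (graphInterior G U)ᶜ⟧
      =ᵐ[μ] pottsKernel G w U σ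

end Infinite

/-- The critical parameter `w_c = max {0, 1 - q / Δ}`. -/
def pottsCritical (q Δ : ℕ) : ℝ := max 0 (1 - (q : ℝ) / (Δ : ℝ))

/-! ## `regularTree Δ` is a tree in which every vertex has degree `Δ` -/

theorem regularTree_encard_neighborSet (Δ : ℕ) (v : TreeVertex Δ) :
    ((regularTree Δ).neighborSet v).encard = Δ := by
  classical
  obtain ⟨l, hl⟩ := v
  -- the neighbour reached along the letter `a`
  let f : Fin Δ → TreeVertex Δ := fun a =>
    if h : (a :: l).IsChain (· ≠ ·) then ⟨a :: l, h⟩ else ⟨l.tail, hl.tail⟩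
  have fpos : ∀ a, (a :: l).IsChain (· ≠ ·) → (f a).1 = a :: l := by
    intro a h
    have : f a = ⟨a :: l, h⟩ := dif_pos h
    rw [this]
  have fneg : ∀ a, ¬ (a :: l).IsChain (· ≠ ·) → (f a).1 = l.tail := by
    intro a h
    have : f a = ⟨l.tail, hl.tail⟩ := dif_neg h
    rw [this]
  have key : ∀ a, ¬ (a :: l).IsChain (· ≠ ·) → l = a :: l.tail := by
    intro a h
    cases l with
    | nil => simp at h
    | cons b m =>
      simp only [List.isChain_cons_cons, not_and] at h
      by_cases hab : a = b
      · simp [hab]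
      · exact absurd hl (h hab)
  have key2 : ∀ a m, l = a :: m → ¬ (a :: l).IsChain (· ≠ ·) := by
    rintro a m rfl h
    simp at h
  have hf : Function.Injective f := by
    intro a b hab
    have hab' : (f a).1 = (f b).1 := congrArg Subtype.val hab
    by_cases h1 : (a :: l).IsChain (· ≠ ·) <;> by_cases h2 : (b :: l).IsChain (· ≠ ·)
    · rw [fpos a h1, fpos b h2] at hab'
      exact (List.cons.inj hab').1
    · rw [fpos a h1, fneg b h2] at hab'
      have hlen := congrArg List.length hab'
      rw [List.length_cons, List.length_tail] at hlen
      omega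
    · rw [fneg a h1, fpos b h2] at hab'
      have hlen := congrArg List.length hab'
      rw [List.length_cons, List.length_tail] at hlen
      omega
    · have h := (key a h1).symm.trans (key b h2)
      exact (List.cons.inj h).1
  have hrange : (regularTree Δ).neighborSet ⟨l, hl⟩ = Set.range f := by
    ext u
    constructor
    · rintro (⟨a, h⟩ | ⟨a, h⟩)
      · refine ⟨a, Subtype.ext ?_⟩
        have h' : l = a :: u.1 := h
        rw [fneg a (key2 a _ h'), h']
        rfl
      · refine ⟨a, Subtype.ext ?_⟩
        have h' : u.1 = a :: l := h
        have hc : (a :: l).IsChain (· ≠ ·) := h' ▸ u.2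
        rw [fpos a hc, h']
    · rintro ⟨a, rfl⟩
      by_cases h : (a :: l).IsChain (· ≠ ·)
      · exact Or.inr ⟨a, fpos a h⟩
      · refine Or.inl ⟨a, ?_⟩
        rw [fneg a h]
        exact key a h
  rw [hrange, ← Set.image_univ, hf.encard_image]
  simp

theorem regularTree_isTree (Δ : ℕ) : (regularTree Δ).IsTree := by
  have hroot : ∀ (l : List (Fin Δ)) (hl : l.IsChain (· ≠ ·)),
      (regularTree Δ).Reachable ⟨l, hl⟩ ⟨[], List.isChain_nil⟩ := by
    intro l
    induction l with
    | nil => exact fun _ => SimpleGraph.Reachable.refl _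
    | cons a m ih =>
      intro hl
      have hadj : (regularTree Δ).Adj ⟨a :: m, hl⟩ ⟨m, hl.tail⟩ := Or.inl ⟨a, rfl⟩
      exact hadj.reachable.trans (ih hl.tail)
  -- the edge from `u = a v` to `v` separates the words that end in `u` from all others
  have hcut : ∀ (u v : TreeVertex Δ) (a : Fin Δ), u.1 = a :: v.1 →
      (regularTree Δ).IsBridge s(u, v) := by
    intro u v a h
    rw [SimpleGraph.isBridge_iff]
    rintro ⟨p⟩
    have hclosed : ∀ (x y : TreeVertex Δ),
        ((regularTree Δ).deleteEdges {s(u, v)}).Walk x y → u.1 <:+ x.1 → u.1 <:+ y.1 := by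
      intro x y p
      induction p with
      | nil => exact id
      | @cons x z y hxz p ih =>
        intro hx
        apply ih
        rw [SimpleGraph.deleteEdges_adj] at hxz
        obtain ⟨⟨b, hb⟩ | ⟨b, hb⟩, hne⟩ := hxz
        · rw [hb, List.suffix_cons_iff] at hx
          rcases hx with hx | hx
          · exfalso
            apply hne
            have hxu : x = u := Subtype.ext (hb.trans hx.symm)
            have hzv : z = v := Subtype.ext (List.cons.inj (hx.symm.trans h)).2
            rw [hxu, hzv]
            rfl
          · exact hx
        · rw [hb]
          exact hx.trans (List.suffix_cons b x.1)
    have hlen := (hclosed u v p List.suffix_rfl).length_le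
    rw [h] at hlen
    simp at hlen
  have : Nonempty (TreeVertex Δ) := ⟨⟨[], List.isChain_nil⟩⟩
  refine ⟨⟨?_⟩, ?_⟩
  · exact fun x y => (hroot x.1 x.2).trans (hroot y.1 y.2).symm
  · rw [SimpleGraph.isAcyclic_iff_forall_adj_isBridge]
    rintro u v (⟨a, h⟩ | ⟨a, h⟩)
    · exact hcut u v a h
    · rw [Sym2.eq_swap]
      exact hcut v u a h

end

/-!
Uniqueness rests on the tree recursion. Let `d = Δ - 1` and `θ = (1 - w) / q`; the hypothesis
`w_c ≤ w` says that `θ * (d + 1) ≤ 1`. A message is a vector `v` of nonnegative numbers indexed by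
the colours, scaled to mean one, and a vertex whose `d` children send the messages `w a` sends the
message proportional to `∏ a, (1 - θ * w a)`. If all messages from far away are close to the
constant message, then far boundary conditions have no influence: the marginal of a Gibbs measure
on a ball is a mixture of terms "Potts weight of the ball times a product of messages at its sphere"
(`TreeVertex.isMessageMixture_of_isPottsGibbs`), so it has to be proportional to the Potts weight,
and this determines the measure (`TreeVertex.isPottsGibbs_unique`).

The convergence of messages (`exists_messages_near_one`) is a contraction over two levels of the
tree. The distance of `v` from the constant message is measured by `c = max log v - 𝔼 log v`. For
`d → ∞` at the critical parameter, a child whose own children send `w` sends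
`v = exp (-w) / 𝔼 exp (-w)`, and contributes the factor `exp (-v / d)` to the next message. With
`V = max w` the distance of `exp (-v)` is at most `1 - 1 / 𝔼 exp (V - w)`, so the distance does not
grow if `(1 - c) * 𝔼 exp (V - w) ≤ 1` for `c = log V - 𝔼 log w`. In terms of `u = 1 - w / V` this
follows from comparing the power series of `exp (V * u)` and `-log (1 - u)`
(`exp_sub_le_neg_log`), and the comparison leaves a surplus of order `c ^ 3`. Since the linearized
recursion is neutral at the critical parameter, nothing better than a cubic surplus can be expected,
and the errors of order `1 / d` have to be controlled relative to it: to second order they cancel,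
because `(1 + a / d) ^ d` falls short of `exp a` by `a ^ 2 / (2 * d)`
(`binomial_pow_pointwise_le`, `expect_binomial_pow_le`). Different messages from the `d` children
are handled by the arithmetic-geometric mean inequality (`log_sub_le_of_nearUniform`), and
parameters `w > w_c` are reduced to `w_c` by the observation that moving a message towards the
constant one does not increase its distance (`log_one_add_mul_sub_le`). One step of the recursion
brings every message within distance `1.01`, and from there on `c` decreases to `0`.

A Gibbs measure is obtained by giving the root a uniform colour and adding independent increments in
`ℤ / q` along the edges (`TreeVertex.exists_isPottsGibbs`). Its marginals on balls are proportional
to the Potts weight, and this implies the spatial Markov property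
(`TreeVertex.isPottsGibbs_of_treeWeight`).
-/

open scoped BigOperators

/-! ### Elementary inequalities for the exponential and the logarithm -/

lemma pow_div_factorial_succ_le {V : ℝ} (hV0 : 0 ≤ V) (hV : V ≤ 3) (n : ℕ) :
    V ^ (n + 1) / ((n + 2).factorial : ℝ) ≤ V / 2 := by
  induction n with
  | zero => simp [Nat.factorial]
  | succ n ih =>
    have h1 : ((n + 1 + 2).factorial : ℝ) = (n + 3) * ((n + 2).factorial : ℝ) := by
      rw [show n + 1 + 2 = (n + 2) + 1 by ring, Nat.factorial_succ]; push_cast; ring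
    have hf : (0 : ℝ) < (n + 2).factorial := by positivity
    have h2 : V ^ (n + 1 + 1) / ((n + 1 + 2).factorial : ℝ)
        = (V ^ (n + 1) / ((n + 2).factorial : ℝ)) * (V / (n + 3)) := by
      rw [h1]; field_simp; ring
    have h3 : V / ((n : ℝ) + 3) ≤ 1 := by
      rw [div_le_one (by positivity)]
      have : (0 : ℝ) ≤ n := by positivity
      linarith
    rw [h2]
    calc _ ≤ (V ^ (n + 1) / ((n + 2).factorial : ℝ)) * 1 := by gcongr
      _ ≤ V / 2 := by rw [mul_one]; exact ih

lemma hasSum_exp_sub_one_sub (x : ℝ) :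
    HasSum (fun n : ℕ => x ^ (n + 2) / ((n + 2).factorial : ℝ)) (Real.exp x - 1 - x) := by
  have h : HasSum (fun n : ℕ => x ^ n / (n.factorial : ℝ)) (Real.exp x) := by
    rw [Real.exp_eq_exp_ℝ]
    exact NormedSpace.expSeries_div_hasSum_exp x
  rw [← hasSum_nat_add_iff' 2] at h
  have e : Real.exp x - 1 - x = Real.exp x - ∑ i ∈ Finset.range 2, x ^ i / (i.factorial : ℝ) := by
    rw [Finset.sum_range_succ, Finset.sum_range_one]
    norm_num
    ring
  rw [e]
  exact h

lemma hasSum_neg_log_one_sub_sub {u : ℝ} (hu0 : 0 ≤ u) (hu : u < 1) :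
    HasSum (fun n : ℕ => u ^ (n + 2) / ((n : ℝ) + 2)) (-Real.log (1 - u) - u) := by
  have h := Real.hasSum_pow_div_log_of_abs_lt_one (x := u) (by rw [abs_of_nonneg hu0]; exact hu)
  rw [← hasSum_nat_add_iff' 1] at h
  have e : -Real.log (1 - u) - u
      = -Real.log (1 - u) - ∑ i ∈ Finset.range 1, u ^ (i + 1) / ((i : ℝ) + 1) := by simp
  rw [e]
  have e' : (fun n : ℕ => u ^ (n + 2) / ((n : ℝ) + 2))
      = fun n : ℕ => u ^ (n + 1 + 1) / (((n + 1 : ℕ) : ℝ) + 1) := by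
    ext n; push_cast; ring
  rw [e']
  exact h

/-- The exponential is dominated by the logarithm, with a cubic surplus.  Termwise comparison of
the power series: `1 ≤ K` and `V / 2 + 1 / 10 ≤ K` are what the coefficients of `u ^ 2` and `u ^ 3`
ask for, and for `V ≤ 3` the later coefficients follow from these. -/
lemma exp_sub_le_neg_log {u V K : ℝ} (hu0 : 0 ≤ u) (hu : u < 1) (hV0 : 0 ≤ V) (hV : V ≤ 3)
    (hK1 : 1 ≤ K) (hK : V / 2 + 1 / 10 ≤ K) :
    Real.exp (V * u) - 1 - V * u ≤ V ^ 2 * (K * (-Real.log (1 - u) - u) - u ^ 3 / 30) := by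
  have h1 := hasSum_exp_sub_one_sub (V * u)
  have h2 := ((hasSum_neg_log_one_sub_sub hu0 hu).mul_left K).sub
    (hasSum_ite_eq (1 : ℕ) (u ^ 3 / 30))
  refine hasSum_le (fun n => ?_) h1 (h2.mul_left (V ^ 2))
  rcases n with _ | _ | n
  · simp only [zero_add, zero_ne_one, if_false]
    norm_num [Nat.factorial]
    have : 0 ≤ V ^ 2 * u ^ 2 := by positivity
    nlinarith
  · simp only [zero_add, if_true]
    norm_num [Nat.factorial]
    have : 0 ≤ V ^ 2 * u ^ 3 := by positivity
    nlinarith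
  · rw [if_neg (by omega)]
    have hp := pow_div_factorial_succ_le hV0 hV (n + 1)
    have hf : ((n + 1 + 1 + 2).factorial : ℝ) = (n + 4) * ((n + 1 + 2).factorial : ℝ) := by
      rw [show n + 1 + 1 + 2 = (n + 1 + 2) + 1 by ring, Nat.factorial_succ]; push_cast; ring
    have hfp : (0 : ℝ) < (n + 1 + 2).factorial := by positivity
    have e1 : (V * u) ^ (n + 1 + 1 + 2) / ((n + 1 + 1 + 2).factorial : ℝ)
        = (V ^ 2 * u ^ (n + 4) / (n + 4)) * (V ^ (n + 1 + 1) / ((n + 1 + 2).factorial : ℝ)) := by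
      rw [hf, mul_pow]; field_simp; ring
    have e2 : V ^ 2 * (K * (u ^ (n + 1 + 1 + 2) / (((n + 1 + 1 : ℕ) : ℝ) + 2)) - 0)
        = (V ^ 2 * u ^ (n + 4) / (n + 4)) * K := by
      push_cast; ring
    rw [e1, e2]
    gcongr
    linarith

lemma sq_add_cube_le_neg_log {u : ℝ} (hu0 : 0 ≤ u) (hu : u < 1) :
    u ^ 2 / 2 + u ^ 3 / 3 ≤ -Real.log (1 - u) - u := by
  have h := hasSum_neg_log_one_sub_sub hu0 hu
  have := sum_le_hasSum (Finset.range 2) (fun n _ => by positivity) h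
  simp only [Finset.sum_range_succ, Finset.sum_range_zero] at this
  norm_num at this
  linarith

/-- The binomial power falls short of the exponential by `a ^ 2 / (2 d)` to second order. -/
lemma one_add_div_pow_le {d : ℕ} (hd : 1 ≤ d) {a : ℝ} (ha : 0 ≤ a) :
    (1 + a / d) ^ d ≤ 1 + a + (1 - 1 / (d : ℝ)) * (Real.exp a - 1 - a) := by
  obtain ⟨e, rfl⟩ : ∃ e, d = e + 1 := ⟨d - 1, by omega⟩
  have hd0 : (0 : ℝ) < ((e + 1 : ℕ) : ℝ) := by positivity
  have hterm : ∀ n : ℕ, (a / ((e + 1 : ℕ) : ℝ)) ^ (n + 2) * ((e + 1).choose (n + 2) : ℝ)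
      ≤ (1 - 1 / ((e + 1 : ℕ) : ℝ)) * (a ^ (n + 2) / ((n + 2).factorial : ℝ)) := by
    intro n
    have hdesc : (e + 1).descFactorial (n + 2) ≤ e * (e + 1) ^ (n + 1) := by
      rw [Nat.succ_descFactorial_succ]
      rcases e with _ | e
      · simp
      · rw [Nat.succ_descFactorial_succ]
        have := Nat.descFactorial_le_pow e n
        have h2 : e ^ n ≤ (e + 1 + 1) ^ n := Nat.pow_le_pow_left (by omega) n
        calc (e + 1 + 1) * ((e + 1) * e.descFactorial n)
            ≤ (e + 1 + 1) * ((e + 1) * (e + 1 + 1) ^ n) := by gcongr; omega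
          _ = (e + 1) * (e + 1 + 1) ^ (n + 1) := by ring
    have hch : ((e + 1).choose (n + 2) : ℝ) * ((n + 2).factorial : ℝ)
        ≤ e * ((e + 1 : ℕ) : ℝ) ^ (n + 1) := by
      have : (e + 1).choose (n + 2) * (n + 2).factorial ≤ e * (e + 1) ^ (n + 1) := by
        rw [mul_comm, ← Nat.descFactorial_eq_factorial_mul_choose]; exact hdesc
      exact_mod_cast this
    have hf : (0 : ℝ) < (n + 2).factorial := by positivity
    have e1 : (1 - 1 / ((e + 1 : ℕ) : ℝ)) * (a ^ (n + 2) / ((n + 2).factorial : ℝ))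
        = (a / ((e + 1 : ℕ) : ℝ)) ^ (n + 2) *
          (e * ((e + 1 : ℕ) : ℝ) ^ (n + 1) / ((n + 2).factorial : ℝ)) := by
      rw [div_pow]; field_simp; push_cast; ring
    rw [e1]
    gcongr
    rw [le_div_iff₀ hf]; exact hch
  rw [add_comm (1 : ℝ) (a / _), add_pow]
  have hs : ∑ m ∈ Finset.range (e + 1 + 1),
      (a / ((e + 1 : ℕ) : ℝ)) ^ m * 1 ^ (e + 1 - m) * ((e + 1).choose m : ℝ)
      = 1 + a + ∑ n ∈ Finset.range e,
        (a / ((e + 1 : ℕ) : ℝ)) ^ (n + 2) * ((e + 1).choose (n + 2) : ℝ) := by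
    rw [Finset.sum_range_succ', Finset.sum_range_succ']
    simp
    field_simp
    ring
  rw [hs]
  have hd1 : 0 ≤ 1 - 1 / ((e + 1 : ℕ) : ℝ) := by
    rw [sub_nonneg, div_le_one hd0]
    exact_mod_cast hd
  have hsum := sum_le_hasSum (Finset.range e)
    (fun n _ => mul_nonneg hd1 (by positivity : 0 ≤ a ^ (n + 2) / ((n + 2).factorial : ℝ)))
    ((hasSum_exp_sub_one_sub a).mul_left (1 - 1 / ((e + 1 : ℕ) : ℝ)))
  have := Finset.sum_le_sum (fun n (_ : n ∈ Finset.range e) => hterm n)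
  linarith

lemma exp_three_le : Real.exp 3 ≤ 22 := by
  have h := Real.exp_one_lt_d9
  have e : Real.exp 3 = Real.exp 1 ^ 3 := by rw [← Real.exp_nat_mul]; norm_num
  rw [e]
  have h0 : 0 < Real.exp 1 := Real.exp_pos 1
  calc Real.exp 1 ^ 3 ≤ 2.8 ^ 3 := by gcongr; linarith
    _ ≤ 22 := by norm_num

lemma exp_sub_one_sub_le_sq {a : ℝ} (ha0 : 0 ≤ a) (ha : a ≤ 3) :
    Real.exp a - 1 - a ≤ 2 * a ^ 2 := by
  have h1 := hasSum_exp_sub_one_sub a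
  have h2 := (hasSum_exp_sub_one_sub 3).mul_left (a ^ 2 / 9)
  have h3 : Real.exp a - 1 - a ≤ a ^ 2 / 9 * (Real.exp 3 - 1 - 3) := by
    refine hasSum_le (fun n => ?_) h1 h2
    have e : a ^ 2 / 9 * (3 ^ (n + 2) / ((n + 2).factorial : ℝ))
        = a ^ 2 * 3 ^ n / ((n + 2).factorial : ℝ) := by ring
    rw [e, show a ^ (n + 2) = a ^ 2 * a ^ n by ring]
    gcongr
  have h4 := exp_three_le
  nlinarith [sq_nonneg a]

lemma sq_half_le_exp_sub_one_sub {a : ℝ} (ha0 : 0 ≤ a) : a ^ 2 / 2 ≤ Real.exp a - 1 - a := by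
  have := Real.quadratic_le_exp_of_nonneg ha0
  linarith

lemma exp_sub_one_sub_le_add {a b : ℝ} (hb : 0 ≤ b) (hab : b ≤ a) (ha : a ≤ 3) :
    Real.exp a - 1 - a ≤ Real.exp b - 1 - b + 7 * a * (a - b) := by
  have h1 : Real.exp a - Real.exp b ≤ Real.exp a * (a - b) := by
    have h := Real.add_one_le_exp (b - a)
    have e : Real.exp b = Real.exp a * Real.exp (b - a) := by rw [← Real.exp_add]; ring_nf
    rw [e]
    nlinarith [Real.exp_pos a]
  have h2 := exp_sub_one_sub_le_sq (hb.trans hab) ha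
  have h3 : Real.exp a - 1 ≤ 7 * a := by nlinarith
  nlinarith [mul_le_mul_of_nonneg_right h3 (sub_nonneg.2 hab)]

set_option maxHeartbeats 1000000 in
/-- The one-colour estimate behind `expect_binomial_pow_le`: the polynomial in
`W = (1 + β u / d) ^ d - 1` is compared with its limit as `d → ∞`; everything of second order in
`u` that is not paid for by a factor `c` or `μ` cancels. -/
lemma binomial_pow_pointwise_le {d : ℕ} (hd : 100000 ≤ d) {u V K k c μ β W : ℝ}
    (hu0 : 0 ≤ u) (hu : u < 1) (hV1 : 1 ≤ V) (hV : V ≤ 11 / 4)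
    (hK1 : 1 ≤ K) (hK : V / 2 + 1 / 10 ≤ K) (hk0 : 0 ≤ k) (hk1 : k ≤ 1) (hc : 0 ≤ c)
    (hkc : 1 - k ≤ 101 / 100 * c) (hμ0 : 0 ≤ μ)
    (hβ : β = V + V ^ 2 * μ / ((d : ℝ) + 1 - V)) (hβ3 : β ≤ 3)
    (hW : W = (1 + β * u / d) ^ d - 1) :
    k * W + W ^ 2 / (2 * d) + W ^ 3 / (d : ℝ) ^ 2
      ≤ k * (β * u) + k * (V ^ 2 * (K * (-Real.log (1 - u) - u) - u ^ 3 / 30))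
        + (317 * u ^ 3 + 5 * c * u ^ 2 + 189 * μ * u ^ 2) / d := by
  have hd' : (100000 : ℝ) ≤ d := by exact_mod_cast hd
  have hd0 : (0 : ℝ) < d := by linarith
  have hDV : 0 < (d : ℝ) + 1 - V := by linarith
  have hβV : V ≤ β := by rw [hβ]; have : 0 ≤ V ^ 2 * μ / ((d : ℝ) + 1 - V) := by positivity
                         linarith
  have hβV9 : β - V ≤ 9 * μ / d := by
    rw [hβ, add_sub_cancel_left, div_le_div_iff₀ hDV hd0]
    have h1 : V ^ 2 ≤ 121 / 16 := by nlinarith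
    have h2 : V ^ 2 * d ≤ 9 * ((d : ℝ) + 1 - V) := by nlinarith
    nlinarith
  set a := β * u with ha
  have hβ0 : 0 ≤ β := by linarith
  have ha0 : 0 ≤ a := by positivity
  have ha3u : a ≤ 3 * u := by rw [ha]; gcongr
  have ha3 : a ≤ 3 := by linarith
  have hW0 : 0 ≤ W := by
    rw [hW, sub_nonneg]
    exact one_le_pow₀ (by have : 0 ≤ a / d := by positivity
                          linarith)
  have hg2 := sq_half_le_exp_sub_one_sub ha0
  have hg2' := exp_sub_one_sub_le_sq ha0 ha3
  have hW1 : W ≤ a + (Real.exp a - 1 - a) - a ^ 2 / (2 * d) := by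
    have h := one_add_div_pow_le (by omega : 1 ≤ d) ha0
    have h2 : a ^ 2 / (2 * d) ≤ 1 / (d : ℝ) * (Real.exp a - 1 - a) := by
      calc a ^ 2 / (2 * d) = 1 / (d : ℝ) * (a ^ 2 / 2) := by field_simp
        _ ≤ _ := by gcongr
    rw [hW]
    linarith
  have hW2 : W ≤ a + 2 * a ^ 2 := by
    have : 0 ≤ a ^ 2 / (2 * d) := by positivity
    linarith
  have hW7 : W ≤ 7 * a := by nlinarith
  have hsq : W ^ 2 ≤ a ^ 2 + 16 * a ^ 3 := by
    calc W ^ 2 ≤ (a + 2 * a ^ 2) ^ 2 := by gcongr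
      _ = a ^ 2 + 16 * a ^ 3 - 4 * (a ^ 3 * (3 - a)) := by ring
      _ ≤ _ := by
        have := mul_nonneg (pow_nonneg ha0 3) (sub_nonneg.2 ha3)
        linarith
  have hcu : W ^ 3 ≤ 343 * a ^ 3 := by
    calc W ^ 3 ≤ (7 * a) ^ 3 := by gcongr
      _ = _ := by ring
  have ha3' : a ^ 3 ≤ 27 * u ^ 3 := by
    calc a ^ 3 ≤ (3 * u) ^ 3 := by gcongr
      _ = _ := by ring
  have ha2' : a ^ 2 ≤ 9 * u ^ 2 := by
    calc a ^ 2 ≤ (3 * u) ^ 2 := by gcongr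
      _ = _ := by ring
  have hlim : Real.exp a - 1 - a
      ≤ V ^ 2 * (K * (-Real.log (1 - u) - u) - u ^ 3 / 30) + 189 * μ * u ^ 2 / d := by
    have h1 := exp_sub_one_sub_le_add (by positivity : 0 ≤ V * u)
      (by rw [ha]; gcongr : V * u ≤ a) ha3
    have h2 := exp_sub_le_neg_log hu0 hu (by linarith : 0 ≤ V) (by linarith) hK1 hK
    have h3 : 7 * a * (a - V * u) ≤ 189 * μ * u ^ 2 / d := by
      calc 7 * a * (a - V * u) = 7 * a * ((β - V) * u) := by rw [ha]; ring
        _ ≤ 7 * (3 * u) * ((9 * μ / d) * u) := by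
          have : 0 ≤ β - V := by linarith
          gcongr
        _ = _ := by ring
    linarith
  have hsq' : W ^ 2 / (2 * d) ≤ a ^ 2 / (2 * d) + 216 * u ^ 3 / d := by
    calc W ^ 2 / (2 * d) ≤ (a ^ 2 + 16 * (27 * u ^ 3)) / (2 * d) := by gcongr; linarith
      _ = _ := by field_simp; ring
  have hcu' : W ^ 3 / (d : ℝ) ^ 2 ≤ u ^ 3 / d := by
    rw [div_le_div_iff₀ (by positivity) hd0]
    have hu3 : 0 ≤ u ^ 3 := by positivity
    have h1 : W ^ 3 ≤ u ^ 3 * d := by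
      have : u ^ 3 * 100000 ≤ u ^ 3 * d := by gcongr
      linarith
    calc W ^ 3 * d ≤ u ^ 3 * d * d := by gcongr
      _ = u ^ 3 * (d : ℝ) ^ 2 := by ring
  have hkW : k * W ≤ k * a + k * (V ^ 2 * (K * (-Real.log (1 - u) - u) - u ^ 3 / 30))
      + 189 * μ * u ^ 2 / d - k * (a ^ 2 / (2 * d)) := by
    have h1 := mul_le_mul_of_nonneg_left hW1 hk0
    have h2 := mul_le_mul_of_nonneg_left hlim hk0
    have h3 : k * (189 * μ * u ^ 2 / d) ≤ 189 * μ * u ^ 2 / d :=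
      mul_le_of_le_one_left (by positivity) hk1
    linarith
  have hrest : a ^ 2 / (2 * d) - k * (a ^ 2 / (2 * d)) ≤ 5 * c * u ^ 2 / d := by
    have e : a ^ 2 / (2 * d) - k * (a ^ 2 / (2 * d)) = (1 - k) * a ^ 2 / (2 * d) := by ring
    rw [e, div_le_div_iff₀ (by positivity) hd0]
    have h1 : (1 - k) * a ^ 2 ≤ (101 / 100 * c) * (9 * u ^ 2) := by gcongr
    have h2 : 0 ≤ c * u ^ 2 := by positivity
    calc (1 - k) * a ^ 2 * d ≤ (101 / 100 * c) * (9 * u ^ 2) * d := by gcongr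
      _ = 909 / 100 * (c * u ^ 2) * d := by ring
      _ ≤ 10 * (c * u ^ 2) * d := by gcongr; norm_num
      _ = _ := by ring
  have hsplit : (317 * u ^ 3 + 5 * c * u ^ 2 + 189 * μ * u ^ 2) / d
      = 216 * u ^ 3 / d + 101 * u ^ 3 / d + 5 * c * u ^ 2 / d + 189 * μ * u ^ 2 / d := by ring
  have hfin : u ^ 3 / d ≤ 101 * u ^ 3 / d := by
    have : 0 ≤ u ^ 3 := by positivity
    gcongr
    linarith
  rw [hsplit]
  linarith

set_option maxHeartbeats 1000000 in
/-- The bookkeeping behind `expect_binomial_pow_le`: `m₂`, `m₃` are the second and third moments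
of `u`, `μ` is its mean and `s = 𝔼 (-log (1 - u) - u)`.  To leading order the left-hand side is
`c - V² s² / 2 - V m₃ / 30`, and the surplus pays for the terms of order `1 / d` and for `γ`. -/
lemma moment_bookkeeping {d V K k c γ μ s β m₂ m₃ : ℝ} (hd : 100000 ≤ d)
    (hV1 : 1 ≤ V) (hV : V ≤ 11 / 4) (hμ : V * μ = V - 1) (hμ0 : 0 ≤ μ) (hs0 : 0 ≤ s)
    (hc : c = μ + s) (hc1 : c ≤ 101 / 100) (hm2 : m₂ ≤ 2 * s)
    (hm3 : m₃ ≤ 3 * s) (hμm2 : μ * m₂ ≤ m₃) (hμm3 : μ ^ 3 ≤ m₃) (hK : K = 1 + V * s / 2)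
    (hβ : β = V + V ^ 2 * μ / (d + 1 - V)) (hγ : γ = c ^ 3 / 10000)
    (hk : k = 1 - (c - γ) * (d + 1) / d) :
    k * (β * μ) + k * (V ^ 2 * (K * s - m₃ / 30)) + (317 * m₃ + 5 * c * m₂ + 189 * μ * m₂) / d
      ≤ c - γ := by
  have hd0 : 0 < d := by linarith
  have hDV : 0 < d + 1 - V := by linarith
  have hc0 : 0 ≤ c := by linarith
  have hμ1 : μ ≤ 1 := by nlinarith
  have hs1 : s ≤ 101 / 100 := by linarith
  have hm30 : 0 ≤ m₃ := le_trans (by positivity) hμm3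
  have hγ0 : 0 ≤ γ := by rw [hγ]; positivity
  have hV0 : 0 < V := by linarith
  have hVsq : V ^ 2 ≤ 121 / 16 := by nlinarith
  have hμc : μ ≤ 7 / 11 := by
    nlinarith
  -- the size of `γ`
  have hγb : γ ≤ (4 * m₃ + 4.04 * s ^ 2) / 10000 := by
    have h1 : c ^ 3 ≤ 4 * (μ ^ 3 + s ^ 3) := by
      rw [hc]
      nlinarith [mul_nonneg (add_nonneg hμ0 hs0) (sq_nonneg (μ - s))]
    have h2 : s ^ 3 ≤ 1.01 * s ^ 2 := by nlinarith [sq_nonneg s]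
    rw [hγ]
    linarith
  -- the terms of order `1 / d`
  have herr : (317 * m₃ + 5 * c * m₂ + 189 * μ * m₂) / d ≤ (511 * m₃ + 10 * s ^ 2) / 100000 := by
    have h1 : c * m₂ ≤ m₃ + 2 * s ^ 2 := by rw [hc]; nlinarith
    have h2 : 317 * m₃ + 5 * c * m₂ + 189 * μ * m₂ ≤ 511 * m₃ + 10 * s ^ 2 := by linarith
    calc _ ≤ (511 * m₃ + 10 * s ^ 2) / d := div_le_div_of_nonneg_right h2 hd0.le
      _ ≤ _ := by gcongr
  have hγd : γ * (d + 1) / d ≤ 2 * γ := by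
    rw [div_le_iff₀ hd0]; nlinarith
  have hkup : k ≤ 1 - c - c / d + 2 * γ := by
    have : k = 1 - c - c / d + γ * (d + 1) / d := by rw [hk]; field_simp; ring
    linarith
  have hcd : 0 ≤ c / d := by positivity
  have hkup' : k ≤ 1 - c + 2 * γ := by linarith
  have hklo : 1 - c - c / d ≤ k := by
    have h : 0 ≤ γ * (d + 1) / d := by positivity
    have : k = 1 - c - c / d + γ * (d + 1) / d := by rw [hk]; field_simp; ring
    linarith
  have hVc : V * (1 - c) = 1 - V * s := by rw [hc]; linarith
  -- first-order part
  have hfirst : k * (β * μ) ≤ (1 - c) * (V * μ) + 4 * γ + m₃ / 10000 := by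
    have hVμ0 : 0 ≤ V * μ := by positivity
    have e : k * (β * μ) = k * (V * μ) + k * V * (V * μ ^ 2 / (d + 1 - V)) := by
      rw [hβ]; field_simp
    have hq0 : 0 ≤ V * μ ^ 2 / (d + 1 - V) := by positivity
    have h1 : k * (V * μ) ≤ (1 - c - c / d + 2 * γ) * (V * μ) := by gcongr
    have h2 : k * V ≤ 1 + 2 * γ * V := by nlinarith [mul_nonneg hV0.le hs0]
    have h3 : k * V * (V * μ ^ 2 / (d + 1 - V)) ≤ (1 + 2 * γ * V) * (V * μ ^ 2 / (d + 1 - V)) := by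
      gcongr
    have h4 : V * μ ^ 2 / (d + 1 - V) ≤ μ * (V * μ) / d + m₃ / 10000 := by
      have e4 : V * μ ^ 2 / (d + 1 - V) = μ * (V * μ) / d + V * (V * μ) * μ ^ 2 / (d * (d + 1 - V)) := by
        have e6 : V * (V * μ) * μ ^ 2 = V * μ ^ 2 * (V - 1) := by rw [hμ]; ring
        rw [e6]
        field_simp
        ring
      rw [e4]
      have : V * (V * μ) * μ ^ 2 / (d * (d + 1 - V)) ≤ m₃ / 10000 := by
        have e5 : V * (V * μ) * μ ^ 2 = V ^ 2 * μ ^ 3 := by ring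
        rw [e5, div_le_div_iff₀ (by positivity) (by norm_num)]
        have h5 : V ^ 2 * μ ^ 3 ≤ 121 / 16 * m₃ := by gcongr
        have h6 : (100000 : ℝ) * 1 ≤ d * (d + 1 - V) := by
          gcongr; linarith
        nlinarith
      linarith
    have h5 : μ * (V * μ) / d ≤ c / d * (V * μ) := by
      have : μ * (V * μ) / d = μ / d * (V * μ) := by ring
      rw [this]
      gcongr
      linarith
    have h6 : V * μ ^ 2 / (d + 1 - V) ≤ 1 / 100 := by
      rw [div_le_div_iff₀ hDV (by norm_num)]
      have : V * μ ^ 2 ≤ 11 / 4 * 1 ^ 2 := by gcongr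
      nlinarith
    have h7 : V * μ ≤ 7 / 4 := by linarith
    have h8 : 2 * γ * V * (V * μ ^ 2 / (d + 1 - V)) ≤ γ / 10 := by
      calc 2 * γ * V * (V * μ ^ 2 / (d + 1 - V)) ≤ 2 * γ * (11 / 4) * (1 / 100) := by gcongr
        _ ≤ γ / 10 := by linarith
    have h9 : 2 * γ * (V * μ) ≤ 2 * γ * (7 / 4) := by gcongr
    rw [e]
    linarith
  -- second-order part
  have hVs : V * s ≤ 11 / 4 * (101 / 100) := by gcongr
  have hVs0 : 0 ≤ V * s := by positivity
  have hKs : k * (V ^ 2 * (K * s)) ≤ (1 - c) * (V ^ 2 * (K * s)) + 37 * γ := by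
    have hK0 : 0 ≤ K := by rw [hK]; linarith
    have hK2 : K ≤ 2.4 := by rw [hK]; linarith
    have h1 : V ^ 2 * (K * s) ≤ 121 / 16 * (2.4 * (101 / 100)) := by gcongr
    have h2 : k * (V ^ 2 * (K * s)) ≤ (1 - c + 2 * γ) * (V ^ 2 * (K * s)) := by gcongr
    have h3 : 2 * γ * (V ^ 2 * (K * s)) ≤ 2 * γ * (121 / 16 * (2.4 * (101 / 100))) := by gcongr
    linarith
  have hm3k : (1 - c - c / d) * (V ^ 2 * (m₃ / 30)) ≤ k * (V ^ 2 * (m₃ / 30)) := by gcongr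
  have hm3k' : m₃ / 30 - V ^ 2 * s ^ 2 / 10 - m₃ / 10000 ≤ (1 - c - c / d) * (V ^ 2 * (m₃ / 30)) := by
    have e : (1 - c - c / d) * (V ^ 2 * (m₃ / 30))
        = V * (V * (1 - c)) * (m₃ / 30) - c / d * (V ^ 2 * (m₃ / 30)) := by ring
    rw [e, hVc]
    have h1 : V ^ 2 * s * (m₃ / 30) ≤ V ^ 2 * s * (3 * s / 30) := by gcongr
    have h2 : c / d * (V ^ 2 * (m₃ / 30)) ≤ (101 / 100) / 100000 * (121 / 16 * (m₃ / 30)) := by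
      gcongr
    have h3 : 1 * (m₃ / 30) ≤ V * (m₃ / 30) := by gcongr
    linarith
  have hmain : (1 - c) * (V * μ) + (1 - c) * (V ^ 2 * (K * s)) ≤ c - V ^ 2 * s ^ 2 / 2 := by
    have e1 : (1 - c) * (V * μ) = μ - s * (V * μ) := by
      have : (1 - c) * (V * μ) = (V * (1 - c)) * μ := by ring
      rw [this, hVc]; ring
    have e2 : (1 - c) * (V ^ 2 * (K * s)) = V * s + V ^ 2 * s ^ 2 / 2 - V ^ 2 * s ^ 2
        - V ^ 3 * s ^ 3 / 2 := by
      have : (1 - c) * (V ^ 2 * (K * s)) = (V * (1 - c)) * (V * (K * s)) := by ring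
      rw [this, hVc, hK]; ring
    rw [e1, e2, hμ, hc]
    have : 0 ≤ V ^ 3 * s ^ 3 := by positivity
    linarith
  have hs2 : s ^ 2 ≤ V ^ 2 * s ^ 2 := by
    have : 1 ≤ V ^ 2 := one_le_pow₀ hV1
    nlinarith [sq_nonneg s]
  have e : k * (V ^ 2 * (K * s - m₃ / 30)) = k * (V ^ 2 * (K * s)) - k * (V ^ 2 * (m₃ / 30)) := by
    ring
  rw [e]
  linarith [sq_nonneg s]

/-! ### One step of the recursion for a single child -/

section Expect
variable {ι : Type*} [Fintype ι]

lemma expect_mono {f g : ι → ℝ} (h : ∀ i, f i ≤ g i) : 𝔼 i, f i ≤ 𝔼 i, g i :=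
  Finset.expect_le_expect fun i _ => h i

variable [Nonempty ι]

lemma expect_log_nonpos {w : ι → ℝ} (hw0 : ∀ j, 0 < w j) (hw1 : 𝔼 j, w j = 1) :
    𝔼 j, Real.log (w j) ≤ 0 := by
  calc 𝔼 j, Real.log (w j) ≤ 𝔼 j, (w j - 1) :=
        expect_mono fun j => Real.log_le_sub_one_of_pos (hw0 j)
    _ = 0 := by rw [Finset.expect_sub_distrib, hw1, Fintype.expect_const, sub_self]

lemma cube_expect_le {u : ι → ℝ} (hu : ∀ j, 0 ≤ u j) :
    (𝔼 j, u j) * 𝔼 j, u j ^ 2 ≤ 𝔼 j, u j ^ 3 ∧ (𝔼 j, u j) ^ 3 ≤ 𝔼 j, u j ^ 3 := by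
  set μ := 𝔼 j, u j with hμ
  have hμ0 : 0 ≤ μ := Finset.expect_nonneg fun j _ => hu j
  have h1 : 0 ≤ 𝔼 j, (u j - μ) ^ 2 := Finset.expect_nonneg fun j _ => sq_nonneg _
  have h2 : 0 ≤ 𝔼 j, (u j - μ) ^ 2 * (u j + μ) :=
    Finset.expect_nonneg fun j _ => mul_nonneg (sq_nonneg _) (add_nonneg (hu j) hμ0)
  have e1 : 𝔼 j, (u j - μ) ^ 2 = 𝔼 j, u j ^ 2 - μ ^ 2 := by
    have : ∀ j, (u j - μ) ^ 2 = u j ^ 2 - (2 * μ) * u j + μ ^ 2 := fun j => by ring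
    simp only [this, Finset.expect_add_distrib, Finset.expect_sub_distrib, ← Finset.mul_expect,
      Fintype.expect_const, ← hμ]
    ring
  have e2 : 𝔼 j, (u j - μ) ^ 2 * (u j + μ) = 𝔼 j, u j ^ 3 - μ * 𝔼 j, u j ^ 2 := by
    have : ∀ j, (u j - μ) ^ 2 * (u j + μ) = u j ^ 3 - μ * u j ^ 2 - μ ^ 2 * u j + μ ^ 3 :=
      fun j => by ring
    simp only [this, Finset.expect_add_distrib, Finset.expect_sub_distrib, ← Finset.mul_expect,
      Fintype.expect_const, ← hμ]
    ring
  rw [e1] at h1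
  rw [e2] at h2
  refine ⟨by linarith, ?_⟩
  nlinarith

lemma le_exp_bound {V : ℝ} (hV0 : 0 < V) (h : Real.log V ≤ 101 / 100) : V ≤ 11 / 4 := by
  have h1 : V ≤ Real.exp (101 / 100) := (Real.log_le_iff_le_exp hV0).1 h
  have h2 : Real.exp (1 / 100) ≤ 100 / 99 := by
    have h3 := Real.one_sub_le_exp_neg (1 / 100)
    rw [Real.exp_neg] at h3
    have h4 := Real.exp_pos (1 / 100)
    have h5 : (99 / 100 : ℝ) * Real.exp (1 / 100) ≤ 1 := by
      have := mul_le_mul_of_nonneg_right h3 h4.le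
      rw [inv_mul_cancel₀ h4.ne'] at this
      linarith
    linarith
  have h6 := Real.exp_one_lt_d9
  have h7 : Real.exp (101 / 100) = Real.exp 1 * Real.exp (1 / 100) := by
    rw [← Real.exp_add]; norm_num
  rw [h7] at h1
  have h8 : Real.exp 1 * Real.exp (1 / 100) ≤ 2.7182818286 * (100 / 99) := by gcongr
  norm_num at h8
  linarith

lemma one_le_of_expect_eq_one {w : ι → ℝ} {V : ℝ} (hw1 : 𝔼 j, w j = 1) (hV : ∀ j, w j ≤ V) :
    1 ≤ V := by
  rw [← hw1]
  calc 𝔼 j, w j ≤ 𝔼 _j : ι, V := expect_mono hV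
    _ = V := Fintype.expect_const V

/-- The core estimate.  The vector `w` has mean one and is bounded by `V`, and
`c = 𝔼 log (V / w)` measures its distance from the constant vector.  In the limit `d → ∞` the
claim reads `(1 - c) 𝔼 exp (V - w) ≤ 1`, with cubic surplus. -/
lemma expect_binomial_pow_le {d : ℕ} (hd : 100000 ≤ d) {w : ι → ℝ} {V c k : ℝ}
    (hw0 : ∀ j, 0 < w j) (hw1 : 𝔼 j, w j = 1) (hV : ∀ j, w j ≤ V)
    (hc : c = Real.log V - 𝔼 j, Real.log (w j)) (hc1 : c ≤ 101 / 100)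
    (hk : k = 1 - (c - c ^ 3 / 10000) * ((d : ℝ) + 1) / d) (hk0 : 0 ≤ k) :
    𝔼 j, (k * (((d + 1 - w j) / (d + 1 - V)) ^ d - 1)
      + (((d + 1 - w j) / (d + 1 - V)) ^ d - 1) ^ 2 / (2 * d)
      + (((d + 1 - w j) / (d + 1 - V)) ^ d - 1) ^ 3 / (d : ℝ) ^ 2) ≤ c - c ^ 3 / 10000 := by
  have hd' : (100000 : ℝ) ≤ d := by exact_mod_cast hd
  have hd0 : (0 : ℝ) < d := by linarith
  have hlog := expect_log_nonpos hw0 hw1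
  have hV1 : 1 ≤ V := one_le_of_expect_eq_one hw1 hV
  have hV0 : 0 < V := by linarith
  have hV2 : V ≤ 11 / 4 := le_exp_bound hV0 (by linarith)
  have hDV : 0 < (d : ℝ) + 1 - V := by linarith
  obtain ⟨u, hu⟩ : ∃ u : ι → ℝ, ∀ j, u j = 1 - w j / V := ⟨_, fun _ => rfl⟩
  have hu0 : ∀ j, 0 ≤ u j := fun j => by
    rw [hu, sub_nonneg, div_le_one hV0]; exact hV j
  have hu1 : ∀ j, u j < 1 := fun j => by
    have : 0 < w j / V := div_pos (hw0 j) hV0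
    rw [hu]; linarith
  have hEu : 𝔼 j, u j = 1 - 1 / V := by
    simp only [hu, Finset.expect_sub_distrib, Fintype.expect_const, ← Finset.expect_div, hw1]
  obtain ⟨μ, hμ⟩ : ∃ μ : ℝ, μ = 1 - 1 / V := ⟨_, rfl⟩
  obtain ⟨s, hs⟩ : ∃ s : ℝ, s = c - μ := ⟨_, rfl⟩
  have hμ0 : 0 ≤ μ := by
    rw [hμ, sub_nonneg, div_le_one hV0]; exact hV1
  have hVμ : V * μ = V - 1 := by rw [hμ]; field_simp
  have hℓ : 𝔼 j, (-Real.log (1 - u j) - u j) = s := by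
    have : ∀ j, -Real.log (1 - u j) - u j = Real.log V - Real.log (w j) - u j := fun j => by
      have : 1 - u j = w j / V := by rw [hu]; ring
      rw [this, Real.log_div (hw0 j).ne' hV0.ne']
      ring
    simp only [this, Finset.expect_sub_distrib, Fintype.expect_const, hEu]
    rw [hs, hc, hμ]
  have hEsq := fun j => sq_add_cube_le_neg_log (hu0 j) (hu1 j)
  have hm2 : 𝔼 j, u j ^ 2 ≤ 2 * s := by
    rw [← hℓ, Finset.mul_expect]
    refine expect_mono fun j => ?_
    have := pow_nonneg (hu0 j) 3
    linarith [hEsq j]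
  have hm3 : 𝔼 j, u j ^ 3 ≤ 3 * s := by
    rw [← hℓ, Finset.mul_expect]
    refine expect_mono fun j => ?_
    have := pow_nonneg (hu0 j) 2
    linarith [hEsq j]
  have hm20 : 0 ≤ 𝔼 j, u j ^ 2 := Finset.expect_nonneg fun j _ => sq_nonneg _
  have hs0 : 0 ≤ s := by linarith
  obtain ⟨hμm2, hμm3⟩ := cube_expect_le hu0
  rw [hEu, ← hμ] at hμm2 hμm3
  have hc0 : 0 ≤ c := by linarith
  obtain ⟨β, hβ⟩ : ∃ β : ℝ, β = V + V ^ 2 * μ / ((d : ℝ) + 1 - V) := ⟨_, rfl⟩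
  have hβ' : β = d * V / (d + 1 - V) := by
    have : V ^ 2 * μ = V * (V - 1) := by rw [← hVμ]; ring
    rw [hβ, this]
    field_simp
    ring
  have hβ3 : β ≤ 3 := by
    rw [hβ', div_le_iff₀ hDV]; nlinarith
  have hKV : V / 2 + 1 / 10 ≤ 1 + V * s / 2 := by
    -- `log V ≥ 2 - e / V`, the tangent of `V log V` at `V = e`
    have h1 : 2 - Real.exp 1 / V ≤ Real.log V := by
      have h := Real.one_sub_inv_le_log_of_pos (div_pos hV0 (Real.exp_pos 1))
      rw [Real.log_div hV0.ne' (Real.exp_pos 1).ne', Real.log_exp, inv_div] at h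
      linarith
    have h2 : 2 * V - Real.exp 1 ≤ V * c := by
      calc 2 * V - Real.exp 1 = V * (2 - Real.exp 1 / V) := by field_simp
        _ ≤ V * c := by gcongr; linarith
    have h3 : V * s = V * c - (V - 1) := by rw [hs, ← hVμ]; ring
    have := Real.exp_one_lt_d9
    linarith
  have hγ1 : c ^ 3 / 10000 ≤ c / 1000 := by nlinarith [mul_nonneg hc0 hc0]
  have hγ0 : 0 ≤ c ^ 3 / 10000 := by positivity
  have hk1 : k ≤ 1 := by
    rw [hk, sub_le_self_iff]
    exact div_nonneg (mul_nonneg (by linarith) (by linarith)) hd0.le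
  have hkc : 1 - k ≤ 101 / 100 * c := by
    rw [hk, sub_sub_cancel, div_le_iff₀ hd0]
    nlinarith
  have hpt := fun j => binomial_pow_pointwise_le hd (hu0 j) (hu1 j) hV1 hV2
    (by have : 0 ≤ V * s := by positivity
        linarith : 1 ≤ 1 + V * s / 2) hKV hk0 hk1 hc0 hkc hμ0 hβ hβ3 rfl
  have hX : ∀ j, (d + 1 - w j) / (d + 1 - V) = 1 + β * u j / d := fun j => by
    rw [hβ', hu]; field_simp; ring
  simp only [hX]
  refine (expect_mono hpt).trans ?_
  refine le_trans (le_of_eq ?_) (moment_bookkeeping hd' hV1 hV2 hVμ hμ0 hs0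
    (by rw [hs]; ring) hc1 hm2 hm3 hμm2 hμm3 rfl hβ rfl hk)
  simp only [Finset.expect_add_distrib, Finset.expect_sub_distrib, ← Finset.mul_expect,
    ← Finset.expect_div, hℓ, hEu, ← hμ]

end Expect

lemma neg_log_one_sub_le {t : ℝ} (ht0 : 0 ≤ t) (ht : t ≤ 1 / 4) :
    -Real.log (1 - t) ≤ t + t ^ 2 / 2 + t ^ 3 := by
  have h := Real.abs_log_sub_add_sum_range_le (x := t) (by rw [abs_of_nonneg ht0]; linarith) 3
  rw [abs_of_nonneg ht0] at h
  simp only [Finset.sum_range_succ, Finset.sum_range_zero] at h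
  norm_num at h
  have h1 := (abs_le.1 h).1
  have h2 : t ^ 4 / (1 - t) ≤ t ^ 3 / 3 := by
    rw [div_le_div_iff₀ (by linarith) (by norm_num)]
    nlinarith [pow_nonneg ht0 3]
  linarith [pow_nonneg ht0 3]

section Child
variable {ι : Type*} [Fintype ι]

/-- The vectors `v` of positive weights with mean one that are within `c` of the constant vector,
as measured by the excess of `log v` over its mean. -/
structure NearUniform (c : ℝ) (v : ι → ℝ) : Prop where
  pos : ∀ j, 0 < v j
  expect_eq_one : 𝔼 j, v j = 1
  log_sub_le : ∀ i, Real.log (v i) - 𝔼 j, Real.log (v j) ≤ c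

variable [Nonempty ι]

lemma sub_cube_mono {a b : ℝ} (ha : 0 ≤ a) (hab : a ≤ b) (hb : b ≤ 101 / 100) :
    a - a ^ 3 / 10000 ≤ b - b ^ 3 / 10000 := by
  have e : (b - b ^ 3 / 10000) - (a - a ^ 3 / 10000)
      = (b - a) * (1 - (a ^ 2 + a * b + b ^ 2) / 10000) := by ring
  have h : 0 ≤ (b - a) * (1 - (a ^ 2 + a * b + b ^ 2) / 10000) := by
    apply mul_nonneg (by linarith)
    nlinarith
  linarith

/-- The maximal entry `V` of `w`, with the bounds that make the core estimate applicable. -/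
lemma NearUniform.exists_max {c : ℝ} {w : ι → ℝ} (hw : NearUniform c w) (hc1 : c ≤ 101 / 100) :
    ∃ V : ℝ, (∀ j, w j ≤ V) ∧ 1 ≤ V ∧ V ≤ 11 / 4 ∧
      0 ≤ Real.log V - 𝔼 j, Real.log (w j) ∧ Real.log V - 𝔼 j, Real.log (w j) ≤ c := by
  obtain ⟨i, hi⟩ := Finite.exists_max w
  have h1 := one_le_of_expect_eq_one hw.expect_eq_one hi
  have hlog := expect_log_nonpos hw.pos hw.expect_eq_one
  have h2 := hw.log_sub_le i
  have h3 := Real.log_nonneg h1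
  exact ⟨w i, hi, h1, le_exp_bound (hw.pos i) (by linarith), by linarith, h2⟩

lemma ratio_pow_le {d : ℕ} (hd : 100000 ≤ d) {w V : ℝ} (hw0 : 0 < w) (hwV : w ≤ V)
    (hV : V ≤ 11 / 4) : ((d + 1 - w) / (d + 1 - V)) ^ d ≤ 22 := by
  have hd' : (100000 : ℝ) ≤ d := by exact_mod_cast hd
  have hDV : 0 < (d : ℝ) + 1 - V := by linarith
  have h1 : (d + 1 - w) / (d + 1 - V) ≤ Real.exp (V / (d + 1 - V)) := by
    have h := Real.add_one_le_exp (V / ((d : ℝ) + 1 - V))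
    refine le_trans ?_ h
    rw [div_add_one hDV.ne']
    gcongr
    linarith
  have h0 : 0 ≤ (d + 1 - w) / (d + 1 - V) := div_nonneg (by linarith) hDV.le
  calc ((d + 1 - w) / (d + 1 - V)) ^ d ≤ Real.exp (V / (d + 1 - V)) ^ d := by gcongr
    _ = Real.exp (d * (V / (d + 1 - V))) := by rw [← Real.exp_nat_mul]
    _ ≤ Real.exp 3 := by
      apply Real.exp_le_exp.2
      rw [mul_div_assoc', div_le_iff₀ hDV]
      nlinarith
    _ ≤ 22 := exp_three_le

/-- The core estimate with an upper bound `c` for the distance in place of the distance itself.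
When the factor `k` of the core estimate is negative, it may be replaced by `0`. -/
lemma NearUniform.expect_pow_le {d : ℕ} (hd : 100000 ≤ d) {c : ℝ} {w : ι → ℝ}
    (hw : NearUniform c w) (hc1 : c ≤ 101 / 100) {V : ℝ} (hV : ∀ j, w j ≤ V)
    (hV2 : V ≤ 11 / 4) (hL0 : 0 ≤ Real.log V - 𝔼 j, Real.log (w j))
    (hL : Real.log V - 𝔼 j, Real.log (w j) ≤ c) :
    𝔼 j, (max 0 (1 - (c - c ^ 3 / 10000) * ((d : ℝ) + 1) / d)
        * (((d + 1 - w j) / (d + 1 - V)) ^ d - 1)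
      + (((d + 1 - w j) / (d + 1 - V)) ^ d - 1) ^ 2 / (2 * d)
      + (((d + 1 - w j) / (d + 1 - V)) ^ d - 1) ^ 3 / (d : ℝ) ^ 2) ≤ c - c ^ 3 / 10000 := by
  have hd' : (100000 : ℝ) ≤ d := by exact_mod_cast hd
  have hd0 : (0 : ℝ) < d := by linarith
  have hDV : 0 < (d : ℝ) + 1 - V := by linarith
  obtain ⟨W, hW⟩ : ∃ W : ι → ℝ, ∀ j, W j = ((d + 1 - w j) / (d + 1 - V)) ^ d - 1 :=
    ⟨_, fun _ => rfl⟩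
  have hW0 : ∀ j, 0 ≤ W j := fun j => by
    rw [hW, sub_nonneg]
    refine one_le_pow₀ ?_
    rw [one_le_div hDV]
    linarith [hV j]
  have hW1 : ∀ j, W j ≤ 21 := fun j => by
    have := ratio_pow_le hd (hw.pos j) (hV j) hV2
    rw [hW]; linarith
  simp only [← hW]
  obtain ⟨c', hc'⟩ : ∃ c', c' = Real.log V - 𝔼 j, Real.log (w j) := ⟨_, rfl⟩
  rw [← hc'] at hL0 hL
  have hmono := sub_cube_mono hL0 hL hc1
  rcases le_or_gt 0 (1 - (c - c ^ 3 / 10000) * ((d : ℝ) + 1) / d) with hk | hk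
  · rw [max_eq_right hk]
    have hkk : 1 - (c - c ^ 3 / 10000) * ((d : ℝ) + 1) / d
        ≤ 1 - (c' - c' ^ 3 / 10000) * ((d : ℝ) + 1) / d := by gcongr
    have h := expect_binomial_pow_le hd hw.pos hw.expect_eq_one hV hc' (hL.trans hc1) rfl
      (hk.trans hkk)
    simp only [← hW] at h
    refine le_trans (expect_mono fun j => ?_) (h.trans hmono)
    have := mul_le_mul_of_nonneg_right hkk (hW0 j)
    linarith
  · rw [max_eq_left hk.le]
    -- here `c` is close to one, and the left-hand side is of order `1 / d`
    have h1 : 1 / 2 ≤ c - c ^ 3 / 10000 := by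
      rw [sub_neg, lt_div_iff₀ hd0] at hk
      nlinarith
    refine le_trans ?_ h1
    calc _ ≤ 𝔼 _j : ι, (1 / 2 : ℝ) := expect_mono fun j => ?_
      _ = 1 / 2 := Fintype.expect_const _
    have h2 : W j ^ 2 / (2 * d) ≤ 21 ^ 2 / (2 * 100000) := by
      have := hW0 j
      have := hW1 j
      gcongr
    have h3 : W j ^ 3 / (d : ℝ) ^ 2 ≤ 21 ^ 3 / 100000 ^ 2 := by
      have := hW0 j
      have := hW1 j
      gcongr
    norm_num at h2 h3
    linarith

/-- Arithmetic-geometric mean inequality for a product of `d` factors, combined with the power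
mean inequality. -/
lemma prod_sub_one_pow_le {α : Type*} {A : Finset α} {d : ℕ} (hA : A.card = d) (hd : d ≠ 0)
    {ξ : α → ℝ} (hξ : ∀ a ∈ A, 1 ≤ ξ a) (n : ℕ) :
    (∏ a ∈ A, ξ a - 1) ^ n ≤ ∑ a ∈ A, (1 / (d : ℝ)) * (ξ a ^ d - 1) ^ n := by
  have hsum : ∑ _a ∈ A, (1 / (d : ℝ)) = 1 := by
    rw [Finset.sum_const, hA, nsmul_eq_mul]
    field_simp
  have h1 : ∏ a ∈ A, ξ a ≤ ∑ a ∈ A, (1 / (d : ℝ)) * ξ a ^ d := by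
    have h := Real.geom_mean_le_arith_mean_weighted A (fun _ => 1 / (d : ℝ)) (fun a => ξ a ^ d)
      (fun _ _ => by positivity) hsum (fun a ha => by have := hξ a ha; positivity)
    refine le_trans (le_of_eq (Finset.prod_congr rfl fun a ha => ?_)) h
    rw [one_div, Real.pow_rpow_inv_natCast (by have := hξ a ha; positivity) hd]
  have h2 : ∏ a ∈ A, ξ a - 1 ≤ ∑ a ∈ A, (1 / (d : ℝ)) * (ξ a ^ d - 1) := by
    simp only [mul_sub, Finset.sum_sub_distrib, mul_one, hsum]
    linarith
  have h3 : 0 ≤ ∏ a ∈ A, ξ a - 1 := by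
    have := Finset.one_le_prod hξ
    linarith
  refine le_trans (pow_le_pow_left₀ h3 h2 n) ?_
  exact Real.pow_arith_mean_le_arith_mean_pow A _ _ (fun _ _ => by positivity) hsum
    (fun a ha => by have := one_le_pow₀ (n := d) (hξ a ha); linarith) n

set_option maxHeartbeats 1000000 in
/-- Two levels of the recursion at the critical parameter: if the messages `w a` of the `d`
grandchildren below one child are within `c` of uniform, then the message of that child changes
the logarithm of the next message by at most `(c - c ^ 3 / 10000) / d` in the direction that
matters. -/
lemma log_sub_le_of_nearUniform {α : Type*} {A : Finset α} {d : ℕ} (hd : 100000 ≤ d)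
    (hA : A.card = d) {c : ℝ} (hc1 : c ≤ 101 / 100) {w : α → ι → ℝ}
    (hw : ∀ a ∈ A, NearUniform c (w a)) {v : ι → ℝ} (hv1 : 𝔼 j, v j = 1) {C : ℝ}
    (hv : ∀ j, v j = C * ∏ a ∈ A, ((d : ℝ) + 1 - w a j)) (i : ι) :
    d * (Real.log (d + 1 - v i) - 𝔼 j, Real.log (d + 1 - v j)) ≤ c - c ^ 3 / 10000 := by
  have hd' : (100000 : ℝ) ≤ d := by exact_mod_cast hd
  have hd0 : (0 : ℝ) < d := by linarith
  have hmax : ∀ a, ∃ V : ℝ, a ∈ A → (∀ j, w a j ≤ V) ∧ 1 ≤ V ∧ V ≤ 11 / 4 ∧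
      0 ≤ Real.log V - 𝔼 j, Real.log (w a j) ∧ Real.log V - 𝔼 j, Real.log (w a j) ≤ c := by
    intro a
    by_cases ha : a ∈ A
    · obtain ⟨V, hV⟩ := (hw a ha).exists_max hc1
      exact ⟨V, fun _ => hV⟩
    · exact ⟨0, fun h => absurd h ha⟩
  choose V hV using hmax
  have hDV : ∀ a ∈ A, 0 < (d : ℝ) + 1 - V a := fun a ha => by
    have := (hV a ha).2.2.1
    linarith
  obtain ⟨ξ, hξ⟩ : ∃ ξ : α → ι → ℝ, ∀ a j, ξ a j = (d + 1 - w a j) / (d + 1 - V a) :=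
    ⟨_, fun _ _ => rfl⟩
  have hξ1 : ∀ j, ∀ a ∈ A, 1 ≤ ξ a j := fun j a ha => by
    rw [hξ, one_le_div (hDV a ha)]
    linarith [(hV a ha).1 j]
  obtain ⟨W, hW⟩ : ∃ W : ι → ℝ, ∀ j, W j = ∏ a ∈ A, ξ a j - 1 := ⟨_, fun _ => rfl⟩
  have hW0 : ∀ j, 0 ≤ W j := fun j => by
    have := Finset.one_le_prod (hξ1 j)
    rw [hW]; linarith
  have hd1 : d ≠ 0 := by omega
  have hWpow : ∀ j n, W j ^ n ≤ ∑ a ∈ A, (1 / (d : ℝ)) * (ξ a j ^ d - 1) ^ n := fun j n => by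
    rw [hW]
    exact prod_sub_one_pow_le hA hd1 (hξ1 j) n
  have hsum : ∑ _a ∈ A, (1 / (d : ℝ)) = 1 := by
    rw [Finset.sum_const, hA, nsmul_eq_mul]
    field_simp
  have hW21 : ∀ j, W j ≤ 21 := fun j => by
    have h := hWpow j 1
    simp only [pow_one] at h
    calc W j ≤ ∑ a ∈ A, (1 / (d : ℝ)) * (ξ a j ^ d - 1) := h
      _ ≤ ∑ a ∈ A, (1 / (d : ℝ)) * 21 := by
        refine Finset.sum_le_sum fun a ha => ?_
        have := ratio_pow_le hd ((hw a ha).pos j) ((hV a ha).1 j) (hV a ha).2.2.1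
        rw [← hξ] at this
        gcongr
        linarith
      _ = 21 := by rw [← Finset.sum_mul, hsum, one_mul]
  obtain ⟨k, hk⟩ : ∃ k, k = max 0 (1 - (c - c ^ 3 / 10000) * ((d : ℝ) + 1) / d) := ⟨_, rfl⟩
  have hk0 : 0 ≤ k := by rw [hk]; exact le_max_left _ _
  have hmain : k * 𝔼 j, W j + (𝔼 j, W j ^ 2) / (2 * d) + (𝔼 j, W j ^ 3) / (d : ℝ) ^ 2
      ≤ c - c ^ 3 / 10000 := by
    have hj : ∀ j, k * W j + W j ^ 2 / (2 * d) + W j ^ 3 / (d : ℝ) ^ 2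
        ≤ ∑ a ∈ A, (1 / (d : ℝ)) * (k * (ξ a j ^ d - 1) + (ξ a j ^ d - 1) ^ 2 / (2 * d)
          + (ξ a j ^ d - 1) ^ 3 / (d : ℝ) ^ 2) := by
      intro j
      have h1 := mul_le_mul_of_nonneg_left (hWpow j 1) hk0
      have h2 := div_le_div_of_nonneg_right (hWpow j 2) (by positivity : (0 : ℝ) ≤ 2 * d)
      have h3 := div_le_div_of_nonneg_right (hWpow j 3) (by positivity : (0 : ℝ) ≤ (d : ℝ) ^ 2)
      simp only [pow_one] at h1
      refine (add_le_add (add_le_add h1 h2) h3).trans (le_of_eq ?_)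
      rw [Finset.mul_sum, Finset.sum_div, Finset.sum_div, ← Finset.sum_add_distrib,
        ← Finset.sum_add_distrib]
      exact Finset.sum_congr rfl fun a _ => by ring
    calc _ = 𝔼 j, (k * W j + W j ^ 2 / (2 * d) + W j ^ 3 / (d : ℝ) ^ 2) := by
          simp only [Finset.expect_add_distrib, ← Finset.mul_expect, ← Finset.expect_div]
      _ ≤ _ := expect_mono hj
      _ = ∑ a ∈ A, (1 / (d : ℝ)) * 𝔼 j, (k * (ξ a j ^ d - 1) + (ξ a j ^ d - 1) ^ 2 / (2 * d)
          + (ξ a j ^ d - 1) ^ 3 / (d : ℝ) ^ 2) := by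
          rw [Finset.expect_sum_comm]
          simp only [← Finset.mul_expect]
      _ ≤ ∑ a ∈ A, (1 / (d : ℝ)) * (c - c ^ 3 / 10000) := by
          refine Finset.sum_le_sum fun a ha => ?_
          obtain ⟨g1, _, g3, g4, g5⟩ := hV a ha
          have := (hw a ha).expect_pow_le hd hc1 g1 g3 g4 g5
          rw [← hk] at this
          simp only [← hξ] at this
          gcongr
      _ = _ := by rw [← Finset.sum_mul, hsum, one_mul]
  -- the message of the child, in terms of `W`
  obtain ⟨M, hM⟩ : ∃ M, M = 𝔼 j, (W j + 1) := ⟨_, rfl⟩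
  have hEW : 𝔼 j, W j = M - 1 := by
    rw [hM, Finset.expect_add_distrib, Fintype.expect_const]; ring
  have hM1 : 1 ≤ M := by
    have : 0 ≤ 𝔼 j, W j := Finset.expect_nonneg fun j _ => hW0 j
    linarith
  have hvM : ∀ j, v j = (W j + 1) / M := by
    have h1 : ∀ j, v j = (C * ∏ a ∈ A, ((d : ℝ) + 1 - V a)) * (W j + 1) := fun j => by
      rw [hv, hW, sub_add_cancel, mul_assoc, ← Finset.prod_mul_distrib]
      congr 1
      refine Finset.prod_congr rfl fun a ha => ?_
      rw [hξ]
      have := (hDV a ha).ne'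
      field_simp
    have h2 : (C * ∏ a ∈ A, ((d : ℝ) + 1 - V a)) * M = 1 := by
      rw [hM, Finset.mul_expect]
      exact (Finset.expect_congr rfl fun j _ => (h1 j).symm).trans hv1
    intro j
    rw [h1 j, eq_div_iff (by linarith), mul_right_comm, h2, one_mul]
  obtain ⟨T, hT⟩ : ∃ T, T = ((d : ℝ) + 1) * M - 1 := ⟨_, rfl⟩
  have hTd : (d : ℝ) ≤ T := by rw [hT]; nlinarith
  have hT0 : 0 < T := by linarith
  have hM0 : 0 < M := by linarith
  have ht : ∀ j, W j / T ≤ 1 / 4 := fun j => by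
    rw [div_le_iff₀ hT0]
    linarith [hW21 j]
  have hlogj : ∀ j, Real.log (d + 1 - v j) = Real.log T - Real.log M + Real.log (1 - W j / T) := by
    intro j
    have h1 : (d : ℝ) + 1 - v j = T / M * (1 - W j / T) := by
      rw [hvM, hT]; field_simp; rw [hT] at hT0; field_simp; ring
    have h2 : 0 < 1 - W j / T := by linarith [ht j]
    rw [h1, Real.log_mul (by positivity) h2.ne', Real.log_div hT0.ne' hM0.ne']
  have hlogi : Real.log (1 - W i / T) ≤ 0 := by
    refine Real.log_nonpos (by linarith [ht i]) ?_
    have : 0 ≤ W i / T := div_nonneg (hW0 i) hT0.le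
    linarith
  have hE : Real.log (d + 1 - v i) - 𝔼 j, Real.log (d + 1 - v j)
      ≤ 𝔼 j, (W j / T + (W j / T) ^ 2 / 2 + (W j / T) ^ 3) := by
    simp only [hlogj, Finset.expect_add_distrib, Fintype.expect_const]
    have : -𝔼 j, Real.log (1 - W j / T) ≤ 𝔼 j, (W j / T + (W j / T) ^ 2 / 2 + (W j / T) ^ 3) := by
      rw [← Finset.expect_neg_distrib]
      exact expect_mono fun j => neg_log_one_sub_le (div_nonneg (hW0 j) hT0.le) (ht j)
    simp only [Finset.expect_add_distrib] at this
    linarith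
  have hE2 : 𝔼 j, (W j / T + (W j / T) ^ 2 / 2 + (W j / T) ^ 3)
      = (M - 1 + (𝔼 j, W j ^ 2) / (2 * T) + (𝔼 j, W j ^ 3) / T ^ 2) / T := by
    simp only [div_pow, Finset.expect_add_distrib, ← Finset.expect_div, hEW]
    field_simp
  rw [hE2] at hE
  have hW2 : 0 ≤ 𝔼 j, W j ^ 2 := Finset.expect_nonneg fun j _ => pow_nonneg (hW0 j) 2
  have hW3 : 0 ≤ 𝔼 j, W j ^ 3 := Finset.expect_nonneg fun j _ => pow_nonneg (hW0 j) 3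
  have h2 : (𝔼 j, W j ^ 2) / (2 * T) ≤ (𝔼 j, W j ^ 2) / (2 * d) := by gcongr
  have h3 : (𝔼 j, W j ^ 3) / T ^ 2 ≤ (𝔼 j, W j ^ 3) / (d : ℝ) ^ 2 := by gcongr
  have hk1 : (1 - (c - c ^ 3 / 10000) * ((d : ℝ) + 1) / d) * (M - 1) ≤ k * (M - 1) := by
    rw [hk]
    gcongr
    exact le_max_right _ _
  rw [hEW] at hmain
  have hfin : M - 1 + (𝔼 j, W j ^ 2) / (2 * T) + (𝔼 j, W j ^ 3) / T ^ 2
      ≤ (c - c ^ 3 / 10000) * T / d := by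
    have e : (c - c ^ 3 / 10000) * T / d = (c - c ^ 3 / 10000)
        + ((c - c ^ 3 / 10000) * ((d : ℝ) + 1) / d) * (M - 1) := by
      rw [hT]; field_simp; ring
    rw [e]
    linarith
  calc _ ≤ d * ((M - 1 + (𝔼 j, W j ^ 2) / (2 * T) + (𝔼 j, W j ^ 3) / T ^ 2) / T) := by gcongr
    _ ≤ d * (((c - c ^ 3 / 10000) * T / d) / T) := by gcongr
    _ = _ := by field_simp

end Child

/-! ### The messages of the tree recursion converge to the uniform message -/

section Messages
variable {ι : Type*} [Fintype ι]

lemma le_card_of_expect_eq_one {v : ι → ℝ} (h0 : ∀ j, 0 ≤ v j) (h1 : 𝔼 j, v j = 1) (j : ι) :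
    v j ≤ Fintype.card ι := by
  have h := Fintype.card_mul_expect v
  rw [h1, mul_one] at h
  rw [h]
  exact Finset.single_le_sum (fun i _ => h0 i) (Finset.mem_univ j)

lemma one_add_mul_pos {α y : ℝ} (hα0 : 0 ≤ α) (hα1 : α ≤ 1) (hy : -1 < y) : 0 < 1 + α * y := by
  rcases hα0.eq_or_lt with h | h
  · rw [← h]; norm_num
  · nlinarith

variable (ι) in
/-- The messages that arise after `n` steps of the tree recursion with `d` children per vertex,
from arbitrary probability vectors at the leaves.  Messages are scaled to have mean one, so that
`θ = (1 - w) / q` for the Potts model with parameter `w` and `q` colours. -/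
def messages (d : ℕ) (θ : ℝ) : ℕ → Set (ι → ℝ)
  | 0 => {v | (∀ j, 0 ≤ v j) ∧ 𝔼 j, v j = 1}
  | n + 1 => {v | 𝔼 j, v j = 1 ∧ ∃ (A : Finset (Fin (d + 1))) (w : Fin (d + 1) → ι → ℝ) (C : ℝ),
      0 < C ∧ A.card = d ∧ (∀ a ∈ A, w a ∈ messages d θ n) ∧
      ∀ j, v j = C * ∏ a ∈ A, (1 - θ * w a j)}

variable {d : ℕ} {θ : ℝ}

lemma messages_nonneg_expect (hθ0 : 0 < θ) (hθ : θ * ((d : ℝ) + 1) ≤ 1)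
    (hdq : 100000 + 101 * Fintype.card ι ≤ d) {n : ℕ} {v : ι → ℝ} (hv : v ∈ messages ι d θ n) :
    (∀ j, 0 ≤ v j) ∧ 𝔼 j, v j = 1 ∧ ∀ j, 0 < 1 - θ * v j := by
  have key : ∀ v : ι → ℝ, (∀ j, 0 ≤ v j) → 𝔼 j, v j = 1 → ∀ j, 0 < 1 - θ * v j := by
    intro v h0 h1 j
    have h2 := le_card_of_expect_eq_one h0 h1 j
    have h3 : (Fintype.card ι : ℝ) ≤ d := by
      have : Fintype.card ι ≤ d := by omega
      exact_mod_cast this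
    have : θ * v j ≤ θ * d := by gcongr; linarith
    linarith
  induction n generalizing v with
  | zero => exact ⟨hv.1, hv.2, key v hv.1 hv.2⟩
  | succ n ih =>
    obtain ⟨h1, A, w, C, hC, hA, hw, hvC⟩ := hv
    have h0 : ∀ j, 0 ≤ v j := fun j => by
      rw [hvC]
      exact mul_nonneg hC.le (Finset.prod_nonneg fun a ha => ((ih (hw a ha)).2.2 j).le)
    exact ⟨h0, h1, key v h0 h1⟩

variable [Nonempty ι]

/-- The quantity that measures the distance from uniformity decreases when a vector is moved
towards the constant vector.  This reduces all parameters to the critical one. -/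
lemma log_one_add_mul_sub_le {y : ι → ℝ} (hy : ∀ j, -1 < y j) (hy0 : 𝔼 j, y j = 0) {α c : ℝ}
    (hα0 : 0 ≤ α) (hα1 : α ≤ 1)
    (h : ∀ i, Real.log (1 + y i) - 𝔼 j, Real.log (1 + y j) ≤ c) (i : ι) :
    Real.log (1 + α * y i) - 𝔼 j, Real.log (1 + α * y j) ≤ c := by
  obtain ⟨m, hm⟩ := Finite.exists_max y
  have hym : 0 ≤ y m := by
    rw [← hy0]
    calc 𝔼 j, y j ≤ 𝔼 _j : ι, y m := expect_mono hm
      _ = y m := Fintype.expect_const _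
  have hpos : ∀ j, 0 < 1 + α * y j := fun j => one_add_mul_pos hα0 hα1 (hy j)
  have hconc : ∀ j, α * Real.log (1 + y j) ≤ Real.log (1 + α * y j) := fun j => by
    have h1 := strictConcaveOn_log_Ioi.concaveOn.2 (x := 1 + y j) (y := 1)
      (by simp only [Set.mem_Ioi]; linarith [hy j]) (by simp) hα0 (sub_nonneg.2 hα1) (by ring)
    simp only [smul_eq_mul, Real.log_one, mul_zero, add_zero] at h1
    refine h1.trans (le_of_eq ?_)
    congr 1; ring
  have hE0 : 𝔼 j, Real.log (1 + y j) ≤ 0 := by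
    rw [← hy0]
    exact expect_mono fun j => by
      have := Real.log_le_sub_one_of_pos (show 0 < 1 + y j by linarith [hy j])
      linarith
  have hE : 𝔼 j, Real.log (1 + y j) ≤ 𝔼 j, Real.log (1 + α * y j) := by
    calc 𝔼 j, Real.log (1 + y j) ≤ α * 𝔼 j, Real.log (1 + y j) := by nlinarith
      _ = 𝔼 j, α * Real.log (1 + y j) := Finset.mul_expect _ _ _
      _ ≤ _ := expect_mono hconc
  have h1 : Real.log (1 + α * y i) ≤ Real.log (1 + y m) := by
    apply Real.log_le_log (hpos i)
    have : α * y i ≤ α * y m := by gcongr; exact hm i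
    nlinarith
  linarith [h m]

lemma NearUniform.shrink {c α : ℝ} {w : ι → ℝ} (hw : NearUniform c w) (hα0 : 0 ≤ α)
    (hα1 : α ≤ 1) : NearUniform c fun j => 1 + α * (w j - 1) := by
  have h0 : 𝔼 j, (w j - 1) = 0 := by
    rw [Finset.expect_sub_distrib, hw.expect_eq_one, Fintype.expect_const, sub_self]
  refine ⟨fun j => one_add_mul_pos hα0 hα1 (by linarith [hw.pos j]), ?_, ?_⟩
  · rw [Finset.expect_add_distrib, ← Finset.mul_expect, h0, Fintype.expect_const]; ring
  · refine log_one_add_mul_sub_le (fun j => by linarith [hw.pos j]) h0 hα0 hα1 ?_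
    simpa using hw.log_sub_le

lemma log_mul_prod_sub_le {α : Type*} {A : Finset α} {C b : ℝ} (hC : 0 < C) {g : α → ι → ℝ}
    (hg : ∀ a ∈ A, ∀ j, 0 < g a j)
    (h : ∀ a ∈ A, ∀ i, Real.log (g a i) - 𝔼 j, Real.log (g a j) ≤ b) (i : ι) :
    Real.log (C * ∏ a ∈ A, g a i) - 𝔼 j, Real.log (C * ∏ a ∈ A, g a j) ≤ A.card * b := by
  have hlog : ∀ j, Real.log (C * ∏ a ∈ A, g a j)
      = Real.log C + ∑ a ∈ A, Real.log (g a j) := fun j => by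
    rw [Real.log_mul hC.ne' (Finset.prod_pos fun a ha => hg a ha j).ne',
      Real.log_prod fun a ha => (hg a ha j).ne']
  simp only [hlog, Finset.expect_add_distrib, Fintype.expect_const, Finset.expect_sum_comm]
  rw [add_sub_add_left_eq_sub, ← Finset.sum_sub_distrib, ← nsmul_eq_mul]
  exact Finset.sum_le_card_nsmul _ _ _ fun a ha => h a ha i

/-- After one step from arbitrary messages `w a`, the distance from uniformity is bounded: each
factor `1 - θ * w a` contributes at most `-𝔼 log (1 - θ * w a)`, which is about `θ ≤ 1 / d`. -/
lemma nearUniform_of_mem_messages_one (hθ0 : 0 < θ) (hθ : θ * ((d : ℝ) + 1) ≤ 1)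
    (hdq : 100000 + 101 * Fintype.card ι ≤ d) {v : ι → ℝ} (hv : v ∈ messages ι d θ 1) :
    NearUniform (101 / 100) v := by
  obtain ⟨h1, A, w, C, hC, hA, hw, hvC⟩ := hv
  have hpos := fun a ha => messages_nonneg_expect hθ0 hθ hdq (hw a ha)
  have hdq' : (100000 : ℝ) + 101 * Fintype.card ι ≤ d := by exact_mod_cast hdq
  have hdd : (0 : ℝ) < d := by
    have : (0 : ℝ) ≤ Fintype.card ι := by positivity
    linarith
  refine ⟨fun j => ?_, h1, fun i => ?_⟩
  · rw [hvC]
    exact mul_pos hC (Finset.prod_pos fun a ha => (hpos a ha).2.2 j)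
  · simp only [hvC]
    have hb : ∀ a ∈ A, ∀ i, Real.log (1 - θ * w a i) - 𝔼 j, Real.log (1 - θ * w a j)
        ≤ 101 / 100 / d := by
      intro a ha i
      obtain ⟨g1, g2, g3⟩ := hpos a ha
      have hi : Real.log (1 - θ * w a i) ≤ 0 := by
        refine Real.log_nonpos (g3 i).le ?_
        have := mul_nonneg hθ0.le (g1 i)
        linarith
      have hj : ∀ j, -Real.log (1 - θ * w a j) ≤ 101 / 100 / d * w a j := fun j => by
        have h := Real.one_sub_inv_le_log_of_pos (g3 j)
        have h2 := le_card_of_expect_eq_one g1 g2 j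
        have h3 : (1 - θ * w a j)⁻¹ - 1 ≤ 101 / 100 / d * w a j := by
          have e : (1 - θ * w a j)⁻¹ - 1 = θ * w a j / (1 - θ * w a j) := by
            have := (g3 j).ne'
            field_simp
            ring
          have h4 : θ * d ≤ 101 / 100 * (1 - θ * w a j) := by
            have h5 : θ * w a j ≤ θ * ((d : ℝ) / 101) := by gcongr; linarith
            nlinarith
          rw [e, div_le_iff₀ (g3 j), div_mul_eq_mul_div, div_mul_eq_mul_div, le_div_iff₀ hdd]
          have := mul_le_mul_of_nonneg_left h4 (g1 j)
          linarith
        linarith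
      have hE : -𝔼 j, Real.log (1 - θ * w a j) ≤ 101 / 100 / d := by
        rw [← Finset.expect_neg_distrib]
        refine (expect_mono hj).trans (le_of_eq ?_)
        rw [← Finset.mul_expect, g2, mul_one]
      linarith
    refine (log_mul_prod_sub_le hC (fun a ha => (hpos a ha).2.2) hb i).trans (le_of_eq ?_)
    rw [hA]
    field_simp

/-- The contraction over two levels of the tree. Subcritical `θ` are reduced to the critical value
at both levels by shrinking the messages by the factor `α`. -/
lemma nearUniform_two_step (hθ0 : 0 < θ) (hθ : θ * ((d : ℝ) + 1) ≤ 1)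
    (hdq : 100000 + 101 * Fintype.card ι ≤ d) {n : ℕ} {c : ℝ} (hc1 : c ≤ 101 / 100)
    (hn : ∀ v ∈ messages ι d θ n, NearUniform c v) {v : ι → ℝ}
    (hv : v ∈ messages ι d θ (n + 2)) : NearUniform (c - c ^ 3 / 10000) v := by
  obtain ⟨h1, A, x, C, hC, hA, hx, hvC⟩ := hv
  have hpos := fun a ha => messages_nonneg_expect hθ0 hθ hdq (hx a ha)
  have hdq' : (100000 : ℝ) + 101 * Fintype.card ι ≤ d := by exact_mod_cast hdq
  have hq0 : (0 : ℝ) ≤ Fintype.card ι := by positivity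
  have hdd : (0 : ℝ) < d := by linarith
  have hθ1 : 0 < 1 - θ := by nlinarith
  -- `1 - θ w` is proportional to `d + 1 - (1 + α (w - 1))`
  obtain ⟨α, hα⟩ : ∃ α, α = d * θ / (1 - θ) := ⟨_, rfl⟩
  have hα0 : 0 ≤ α := by rw [hα]; positivity
  have hα1 : α ≤ 1 := by rw [hα, div_le_one hθ1]; linarith
  have hαθ : α * (1 - θ) = d * θ := by rw [hα]; field_simp
  refine ⟨fun j => ?_, h1, fun i => ?_⟩
  · rw [hvC]
    exact mul_pos hC (Finset.prod_pos fun a ha => (hpos a ha).2.2 j)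
  simp only [hvC]
  have hb : ∀ a ∈ A, ∀ i, Real.log (1 - θ * x a i) - 𝔼 j, Real.log (1 - θ * x a j)
      ≤ (c - c ^ 3 / 10000) / d := by
    intro a ha i
    obtain ⟨g1, g2, g3⟩ := hpos a ha
    obtain ⟨-, B, w, C', hC', hB, hw, hxC⟩ := hx a ha
    have hlt : ∀ j, x a j < d + 1 := fun j => by
      have := le_card_of_expect_eq_one g1 g2 j
      linarith
    have hchild : ∀ i, Real.log (d + 1 - x a i) - 𝔼 j, Real.log (d + 1 - x a j)
        ≤ (c - c ^ 3 / 10000) / d := fun i => by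
      rw [le_div_iff₀' hdd]
      refine log_sub_le_of_nearUniform (by omega) hB hc1
        (fun b hb => (hn _ (hw b hb)).shrink hα0 hα1) g2
        (C := C' * ((1 - θ) / d) ^ d) (fun j => ?_) i
      have hBpow : ((1 - θ) / d) ^ d = ∏ _b ∈ B, (1 - θ) / (d : ℝ) := by
        rw [Finset.prod_const, hB]
      rw [hxC, mul_assoc, hBpow, ← Finset.prod_mul_distrib]
      congr 1
      refine Finset.prod_congr rfl fun b _ => ?_
      have : (1 - θ) / d * ((d : ℝ) + 1 - (1 + α * (w b j - 1)))
          = (d * (1 - θ) - α * (1 - θ) * (w b j - 1)) / d := by ring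
      rw [this, hαθ]
      field_simp
      ring
    have hlog : ∀ j, Real.log (1 + -(x a j - 1) / d)
        = Real.log (d + 1 - x a j) - Real.log d := fun j => by
      rw [← Real.log_div (by linarith [hlt j]) hdd.ne']
      congr 1
      field_simp
      ring
    have hlog' : ∀ j, Real.log (1 - θ * x a j)
        = Real.log (1 - θ) + Real.log (1 + α * (-(x a j - 1) / d)) := fun j => by
      have e : 1 - θ * x a j = (1 - θ) * (1 + α * (-(x a j - 1) / d)) := by
        have : (1 - θ) * (1 + α * (-(x a j - 1) / d))
            = (1 - θ) - (α * (1 - θ)) * ((x a j - 1) / d) := by ring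
        rw [this, hαθ]
        field_simp
        ring
      have h3 := g3 j
      rw [e] at h3
      rw [e, Real.log_mul hθ1.ne' (pos_of_mul_pos_right h3 hθ1.le).ne']
    simp only [hlog', Finset.expect_add_distrib, Fintype.expect_const, add_sub_add_left_eq_sub]
    refine log_one_add_mul_sub_le (y := fun j => -(x a j - 1) / d) (fun j => ?_) ?_ hα0 hα1
      (fun i => ?_) i
    · rw [lt_div_iff₀ hdd]; linarith [hlt j]
    · rw [← Finset.expect_div, Finset.expect_neg_distrib, Finset.expect_sub_distrib, g2,
        Fintype.expect_const]
      simp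
    · simp only [hlog, Finset.expect_sub_distrib, Fintype.expect_const]
      linarith [hchild i]
  refine (log_mul_prod_sub_le hC (fun a ha => (hpos a ha).2.2) hb i).trans (le_of_eq ?_)
  rw [hA]
  field_simp

/-- The bounds on the distance from uniformity: cubic decay, since the fixed point is neutral at
the critical parameter. -/
noncomputable def cubicDecay : ℕ → ℝ
  | 0 => 101 / 100
  | n + 1 => cubicDecay n - cubicDecay n ^ 3 / 10000

lemma cubicDecay_bounds (n : ℕ) : 0 ≤ cubicDecay n ∧ cubicDecay n ≤ 101 / 100 := by
  induction n with
  | zero => norm_num [cubicDecay]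
  | succ n ih =>
    obtain ⟨h0, h1⟩ := ih
    have h2 : cubicDecay n ^ 3 ≤ 10000 * cubicDecay n := by nlinarith [mul_nonneg h0 h0]
    have h3 : 0 ≤ cubicDecay n ^ 3 := by positivity
    simp only [cubicDecay]
    constructor <;> linarith

lemma tendsto_cubicDecay : Filter.Tendsto cubicDecay Filter.atTop (nhds 0) := by
  have hanti : Antitone cubicDecay := antitone_nat_of_succ_le fun n => by
    have h3 : 0 ≤ cubicDecay n ^ 3 := pow_nonneg (cubicDecay_bounds n).1 3
    simp only [cubicDecay]
    linarith
  have hL := tendsto_atTop_ciInf hanti ⟨0, by rintro _ ⟨n, rfl⟩; exact (cubicDecay_bounds n).1⟩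
  have hL2 := (Filter.tendsto_add_atTop_iff_nat 1).2 hL
  have hL3 := hL.sub ((hL.pow 3).div_const 10000)
  have h := tendsto_nhds_unique hL2 hL3
  have h0 : (⨅ n, cubicDecay n) ^ 3 = 0 := by linarith
  rw [pow_eq_zero_iff (by norm_num)] at h0
  rwa [h0] at hL

lemma nearUniform_of_mem_messages (hθ0 : 0 < θ) (hθ : θ * ((d : ℝ) + 1) ≤ 1)
    (hdq : 100000 + 101 * Fintype.card ι ≤ d) (m : ℕ) :
    ∀ v ∈ messages ι d θ (2 * m + 1), NearUniform (cubicDecay m) v := by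
  induction m with
  | zero => exact fun v hv => nearUniform_of_mem_messages_one hθ0 hθ hdq hv
  | succ m ih =>
    exact fun v hv => nearUniform_two_step hθ0 hθ hdq (cubicDecay_bounds m).2 ih hv

lemma NearUniform.abs_sub_one_le {c : ℝ} {v : ι → ℝ} (hv : NearUniform c v) (j : ι) :
    |v j - 1| ≤ Fintype.card ι * (Real.exp c - 1) := by
  have hlog := expect_log_nonpos hv.pos hv.expect_eq_one
  have hle : ∀ i, v i ≤ Real.exp c := fun i => by
    rw [← Real.log_le_iff_le_exp (hv.pos i)]
    linarith [hv.log_sub_le i]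
  have h1 : 1 ≤ Real.exp c := one_le_of_expect_eq_one hv.expect_eq_one hle
  have hsum : Fintype.card ι * (Real.exp c - 1) = ∑ i, (Real.exp c - v i) := by
    rw [← Fintype.card_mul_expect, Finset.expect_sub_distrib, hv.expect_eq_one,
      Fintype.expect_const]
  have h2 : Real.exp c - v j ≤ Fintype.card ι * (Real.exp c - 1) := by
    rw [hsum]
    exact Finset.single_le_sum (f := fun i => Real.exp c - v i)
      (fun i _ => sub_nonneg.2 (hle i)) (Finset.mem_univ j)
  have hcard : (1 : ℝ) ≤ Fintype.card ι := by exact_mod_cast Fintype.card_pos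
  rw [abs_le]
  constructor
  · linarith
  · nlinarith [hle j]

/-- All messages from sufficiently far away are close to uniform. -/
lemma exists_messages_near_one (hθ0 : 0 < θ) (hθ : θ * ((d : ℝ) + 1) ≤ 1)
    (hdq : 100000 + 101 * Fintype.card ι ≤ d) {ε : ℝ} (hε : 0 < ε) :
    ∃ r, ∀ v ∈ messages ι d θ r, ∀ j, |v j - 1| ≤ ε := by
  have h : Filter.Tendsto (fun m => Fintype.card ι * (Real.exp (cubicDecay m) - 1))
      Filter.atTop (nhds 0) := by
    have := ((Real.continuous_exp.tendsto 0).comp tendsto_cubicDecay).sub_const 1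
    simpa using this.const_mul (Fintype.card ι : ℝ)
  obtain ⟨m, hm⟩ := (h.eventually (gt_mem_nhds hε)).exists
  exact ⟨2 * m + 1, fun v hv j =>
    ((nearUniform_of_mem_messages hθ0 hθ hdq m v hv).abs_sub_one_le j).trans hm.le⟩

end Messages

/-! ### Balls, layers and Potts weights in the regular tree -/

namespace TreeVertex
variable {Δ : ℕ}

noncomputable instance : DecidableEq (TreeVertex Δ) := Classical.decEq _

instance : Countable (TreeVertex Δ) :=
  inferInstanceAs (Countable {l : List (Fin Δ) // l.IsChain (· ≠ ·)})

/-- The word that names a vertex. -/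
def word (v : TreeVertex Δ) : List (Fin Δ) := v.1

/-- The vertex named by a word. -/
def ofWord (l : List (Fin Δ)) (h : l.IsChain (· ≠ ·)) : TreeVertex Δ := ⟨l, h⟩

@[simp] lemma word_ofWord (l : List (Fin Δ)) (h : l.IsChain (· ≠ ·)) : (ofWord l h).word = l := rfl

lemma isChain_word (v : TreeVertex Δ) : v.word.IsChain (· ≠ ·) := v.2

lemma word_injective : Function.Injective (word : TreeVertex Δ → List (Fin Δ)) :=
  Subtype.val_injective

/-- The neighbour of `v` on the path to the root; the root is its own parent. -/
def parent (v : TreeVertex Δ) : TreeVertex Δ := ofWord v.word.tail v.isChain_word.tail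

@[simp] lemma word_parent (v : TreeVertex Δ) : v.parent.word = v.word.tail := rfl

lemma adj_def {u v : TreeVertex Δ} : (regularTree Δ).Adj u v ↔
    (∃ a, u.word = a :: v.word) ∨ (∃ a, v.word = a :: u.word) := Iff.rfl

lemma adj_iff {u v : TreeVertex Δ} : (regularTree Δ).Adj u v ↔
    (u.word ≠ [] ∧ parent u = v) ∨ (v.word ≠ [] ∧ parent v = u) := by
  have key : ∀ u v : TreeVertex Δ, (∃ a, u.word = a :: v.word) ↔ (u.word ≠ [] ∧ parent u = v) := by
    intro u v
    constructor
    · rintro ⟨a, h⟩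
      exact ⟨by simp [h], word_injective (by simp [h])⟩
    · rintro ⟨h, rfl⟩
      exact ⟨u.word.head h, (List.cons_head_tail h).symm⟩
  exact adj_def.trans (or_congr (key u v) (key v u))

variable (Δ) in
lemma finite_length_le (n : ℕ) : {v : TreeVertex Δ | v.word.length ≤ n}.Finite :=
  (List.finite_length_le (Fin Δ) n).preimage word_injective.injOn

variable (Δ) in
/-- The ball of radius `n` around the root. -/
noncomputable def ball (n : ℕ) : Finset (TreeVertex Δ) := (finite_length_le Δ n).toFinset

variable (Δ) in
/-- The sphere of radius `n` around the root. -/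
noncomputable def layer (n : ℕ) : Finset (TreeVertex Δ) := {v ∈ ball Δ n | v.word.length = n}

@[simp] lemma mem_ball {n : ℕ} {v : TreeVertex Δ} : v ∈ ball Δ n ↔ v.word.length ≤ n := by
  simp [ball]

@[simp] lemma mem_layer {n : ℕ} {v : TreeVertex Δ} : v ∈ layer Δ n ↔ v.word.length = n := by
  simp only [layer, Finset.mem_filter, mem_ball, and_iff_right_iff_imp]
  exact fun h => h.le

lemma length_parent (v : TreeVertex Δ) : (parent v).word.length = v.word.length - 1 := by
  simp [parent]

lemma ball_succ (n : ℕ) : ball Δ (n + 1) = ball Δ n ∪ layer Δ (n + 1) := by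
  ext v
  simp only [mem_ball, Finset.mem_union, mem_layer]
  omega

lemma disjoint_ball_layer (n : ℕ) : Disjoint (ball Δ n) (layer Δ (n + 1)) := by
  rw [Finset.disjoint_left]
  intro v h1 h2
  rw [mem_ball] at h1
  rw [mem_layer] at h2
  omega

lemma exists_subset_ball (S : Finset (TreeVertex Δ)) : ∃ n, 1 ≤ n ∧ S ⊆ ball Δ n := by
  refine ⟨S.sup (fun v => v.word.length) + 1, by omega, fun v hv => ?_⟩
  rw [mem_ball]
  have := Finset.le_sup (f := fun v : TreeVertex Δ => v.word.length) hv
  omega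

lemma innerBoundary_ball_subset (n : ℕ) {v : TreeVertex Δ}
    (hv : v ∈ innerBoundary (regularTree Δ) (ball Δ n)) : v ∈ layer Δ n := by
  obtain ⟨h1, u, hu, hadj⟩ := hv
  rw [mem_ball] at h1 hu
  rw [mem_layer]
  rcases adj_iff.1 hadj with ⟨h, rfl⟩ | ⟨h, rfl⟩
  · rw [length_parent] at hu; omega
  · rw [length_parent] at h1 ⊢
    omega

/-- The letters that lead from `u` to its children. -/
def childLetters (u : TreeVertex Δ) : Finset (Fin Δ) := {a | (a :: u.word).IsChain (· ≠ ·)}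

/-- The vertex reached from `u` along `a` (meaningful for `a ∈ childLetters u`). -/
def child (u : TreeVertex Δ) (a : Fin Δ) : TreeVertex Δ :=
  if h : (a :: u.word).IsChain (· ≠ ·) then ofWord (a :: u.word) h else u

lemma child_val {u : TreeVertex Δ} {a : Fin Δ} (h : a ∈ childLetters u) :
    (child u a).word = a :: u.word := by
  rw [childLetters, Finset.mem_filter] at h
  rw [child, dif_pos h.2, word_ofWord]

lemma card_childLetters {u : TreeVertex Δ} (hu : u.word ≠ []) :
    (childLetters u).card = Δ - 1 := by
  obtain ⟨b, m, hbm⟩ := List.exists_cons_of_ne_nil hu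
  have hl := u.isChain_word
  have : childLetters u = Finset.univ.erase b := by
    ext a
    rw [hbm] at hl
    simp only [childLetters, hbm, List.isChain_cons_cons, Finset.mem_filter, Finset.mem_univ,
      true_and, Finset.mem_erase, and_true]
    exact ⟨fun h => h.1, fun h => ⟨h, hl⟩⟩
  rw [this, Finset.card_erase_of_mem (Finset.mem_univ b), Finset.card_univ, Fintype.card_fin]

lemma prod_layer_succ (n : ℕ) (f : TreeVertex Δ → ℝ) :
    ∏ v ∈ layer Δ (n + 1), f v = ∏ u ∈ layer Δ n, ∏ a ∈ childLetters u, f (child u a) := by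
  rw [← Finset.prod_fiberwise_of_maps_to (g := parent) (t := layer Δ n)]
  · refine Finset.prod_congr rfl fun u hu => ?_
    symm
    refine Finset.prod_bij (fun a _ => child u a) (fun a ha => ?_) (fun a ha b hb h => ?_)
      (fun v hv => ?_) (fun _ _ => rfl)
    · have h := child_val ha
      rw [mem_layer] at hu
      simp only [Finset.mem_filter, mem_layer]
      refine ⟨by rw [h, List.length_cons, hu], word_injective ?_⟩
      simp [h]
    · have h' := congrArg word h
      rw [child_val ha, child_val hb] at h'
      exact (List.cons.inj h').1
    · simp only [Finset.mem_filter, mem_layer] at hv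
      obtain ⟨h1, rfl⟩ := hv
      have hne : v.word ≠ [] := by
        intro h; rw [h] at h1; simp at h1
      have hv : v.word.head hne :: (parent v).word = v.word := List.cons_head_tail hne
      have ha : v.word.head hne ∈ childLetters (parent v) := by
        simp only [childLetters, Finset.mem_filter, Finset.mem_univ, true_and]
        rw [hv]; exact v.isChain_word
      exact ⟨_, ha, word_injective ((child_val ha).trans hv)⟩
  · intro v hv
    rw [mem_layer] at hv ⊢
    rw [length_parent]; omega

variable {q : ℕ}

/-- The factor that an edge with colours `i`, `j` at its ends contributes. -/
def edgeWeight (w : ℝ) (i j : Fin q) : ℝ := if i = j then w else 1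

/-- The vertices of `S` below their parent in `S`; they stand for the edges inside `S`. -/
noncomputable def innerEdges (S : Finset (TreeVertex Δ)) : Finset (TreeVertex Δ) :=
  {v ∈ S | v.word ≠ [] ∧ parent v ∈ S}

/-- The Potts weight of the restriction of `σ` to `S`. -/
noncomputable def treeWeight (w : ℝ) (S : Finset (TreeVertex Δ)) (σ : TreeVertex Δ → Fin q) : ℝ :=
  ∏ v ∈ innerEdges S, edgeWeight w (σ v) (σ (parent v))

lemma edgeWeight_pos {w : ℝ} (hw : 0 < w) (i j : Fin q) : 0 < edgeWeight w i j := by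
  unfold edgeWeight; split_ifs <;> linarith

lemma treeWeight_pos {w : ℝ} (hw : 0 < w) (S : Finset (TreeVertex Δ))
    (σ : TreeVertex Δ → Fin q) : 0 < treeWeight w S σ :=
  Finset.prod_pos fun _ _ => edgeWeight_pos hw _ _

lemma treeWeight_congr {w : ℝ} {S : Finset (TreeVertex Δ)} {σ τ : TreeVertex Δ → Fin q}
    (h : ∀ v ∈ S, σ v = τ v) : treeWeight w S σ = treeWeight w S τ := by
  refine Finset.prod_congr rfl fun v hv => ?_
  simp only [innerEdges, Finset.mem_filter] at hv
  rw [h v hv.1, h _ hv.2.2]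

/-- The Potts weight of the induced subgraph is the product over the edges, each of which joins a
vertex to its parent. -/
lemma pow_monoEdgeCount_eq (w : ℝ) (S : Finset (TreeVertex Δ)) (σ : TreeVertex Δ → Fin q) :
    w ^ monoEdgeCount ((regularTree Δ).induce (S : Set (TreeVertex Δ)))
      (fun v : (S : Set (TreeVertex Δ)) => σ v.1) = treeWeight w S σ := by
  classical
  unfold treeWeight edgeWeight
  rw [Finset.prod_ite, Finset.prod_const, Finset.prod_const_one, mul_one]
  congr 1
  unfold monoEdgeCount
  -- the edge from a vertex to its parent
  let f : ↥(S : Set (TreeVertex Δ)) → Sym2 (S : Set (TreeVertex Δ)) := fun v =>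
    if h : parent v.1 ∈ S then s(v, ⟨parent v.1, h⟩) else s(v, v)
  let A : Set ↥(S : Set (TreeVertex Δ)) :=
    {v | v.1.word ≠ [] ∧ parent v.1 ∈ S ∧ σ v.1 = σ (parent v.1)}
  have hf : ∀ v : ↥(S : Set (TreeVertex Δ)), ∀ h : parent v.1 ∈ S, f v = s(v, ⟨parent v.1, h⟩) :=
    fun v h => dif_pos h
  have himage : {e : Sym2 (S : Set (TreeVertex Δ)) |
      e ∈ ((regularTree Δ).induce (S : Set (TreeVertex Δ))).edgeSet ∧
        (e.map fun v : (S : Set (TreeVertex Δ)) => σ v.1).IsDiag} = f '' A := by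
    ext e
    induction e using Sym2.ind with
    | _ x y =>
      simp only [Set.mem_ofPred_eq, SimpleGraph.mem_edgeSet, SimpleGraph.comap_adj,
        Function.Embedding.subtype_apply, Sym2.map_mk, Sym2.mk_isDiag_iff, Set.mem_image, adj_iff]
      constructor
      · rintro ⟨⟨h, e⟩ | ⟨h, e⟩, hσ⟩
        · have hp : parent x.1 ∈ S := by rw [e]; exact y.2
          refine ⟨x, ⟨h, hp, by rw [e]; exact hσ⟩, ?_⟩
          rw [hf x hp]
          congr 2
        · have hp : parent y.1 ∈ S := by rw [e]; exact x.2
          refine ⟨y, ⟨h, hp, by rw [e]; exact hσ.symm⟩, ?_⟩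
          rw [hf y hp, Sym2.eq_swap]
          congr 2
      · rintro ⟨v, ⟨h, hp, hσ⟩, e⟩
        rw [hf v hp, Sym2.eq_iff] at e
        rcases e with ⟨rfl, rfl⟩ | ⟨rfl, rfl⟩
        · exact ⟨Or.inl ⟨h, rfl⟩, hσ⟩
        · exact ⟨Or.inr ⟨h, rfl⟩, hσ.symm⟩
  have hinj : Set.InjOn f A := by
    rintro x ⟨hx, hpx, -⟩ y ⟨hy, hpy, -⟩ e
    rw [hf x hpx, hf y hpy, Sym2.eq_iff] at e
    rcases e with ⟨h, -⟩ | ⟨h1, h2⟩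
    · exact h
    · exfalso
      have e1 : x.1 = parent y.1 := congrArg Subtype.val h1
      have e2 : parent x.1 = y.1 := congrArg Subtype.val h2
      have l1 := congrArg (fun v : TreeVertex Δ => v.word.length) e1
      have l2 := congrArg (fun v : TreeVertex Δ => v.word.length) e2
      simp only [length_parent] at l1 l2
      have : x.1.word.length ≠ 0 := by simpa using hx
      have : y.1.word.length ≠ 0 := by simpa using hy
      omega
  rw [himage, hinj.ncard_image,
    ← Set.ncard_image_of_injective A Subtype.val_injective, ← Set.ncard_coe_finset]
  congr 1
  ext v
  simp only [A, innerEdges, Set.mem_image, Set.mem_ofPred_eq, Finset.coe_filter,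
    Finset.mem_filter]
  constructor
  · rintro ⟨x, ⟨h1, h2, h3⟩, rfl⟩
    exact ⟨⟨x.2, h1, h2⟩, h3⟩
  · rintro ⟨⟨h0, h1, h2⟩, h3⟩
    exact ⟨⟨v, h0⟩, ⟨h1, h2, h3⟩, rfl⟩

lemma innerEdges_ball_succ (n : ℕ) :
    innerEdges (ball Δ (n + 1)) = innerEdges (ball Δ n) ∪ layer Δ (n + 1) := by
  ext v
  simp only [innerEdges, Finset.mem_filter, mem_ball, Finset.mem_union, mem_layer, length_parent,
    ← List.length_pos_iff]
  omega

lemma treeWeight_ball_succ (w : ℝ) (n : ℕ) (σ : TreeVertex Δ → Fin q) :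
    treeWeight w (ball Δ (n + 1)) σ = treeWeight w (ball Δ n) σ *
      ∏ v ∈ layer Δ (n + 1), edgeWeight w (σ v) (σ (parent v)) := by
  unfold treeWeight
  rw [innerEdges_ball_succ, Finset.prod_union]
  exact (disjoint_ball_layer n).mono_left (Finset.filter_subset _ _)

end TreeVertex

/-! ### Cylinder probabilities -/

section Cylinder
variable {V : Type*} {q : ℕ}

/-- The event that the random configuration agrees with `σ` on `S`. -/
def agree (S : Finset V) (σ : V → Fin q) : Set (V → Fin q) := {ω | ∀ v ∈ S, ω v = σ v}

lemma measurableSet_agree (S : Finset V) (σ : V → Fin q) : MeasurableSet (agree S σ) := by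
  have : agree S σ = ⋂ v ∈ S, (fun ω : V → Fin q => ω v) ⁻¹' {σ v} := by
    ext ω; simp [agree]
  rw [this]
  exact Finset.measurableSet_biInter _ fun v _ => measurable_pi_apply v (measurableSet_singleton _)

lemma agree_congr {S : Finset V} {σ τ : V → Fin q} (h : ∀ v ∈ S, σ v = τ v) :
    agree S σ = agree S τ := by
  ext ω
  exact forall₂_congr fun v hv => by rw [h v hv]

variable [DecidableEq V]

/-- The configuration that equals `τ` on `T` and `σ` elsewhere. -/
def glue (T : Finset V) (τ : ↥(T : Set V) → Fin q) (σ : V → Fin q) : V → Fin q :=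
  fun v => if h : v ∈ (T : Set V) then τ ⟨v, h⟩ else σ v

lemma glue_of_mem {T : Finset V} (τ : ↥(T : Set V) → Fin q) (σ : V → Fin q) {v : V}
    (h : v ∈ (T : Set V)) : glue T τ σ v = τ ⟨v, h⟩ := dif_pos h

lemma glue_of_notMem {T : Finset V} (τ : ↥(T : Set V) → Fin q) (σ : V → Fin q) {v : V}
    (h : v ∉ T) : glue T τ σ v = σ v := dif_neg h

open Classical in
/-- Total probability over the colours on `T`, where `S` and `T` may overlap. -/
lemma measureReal_agree_eq_sum_ite (μ : Measure (V → Fin q)) [IsFiniteMeasure μ]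
    (S T : Finset V) (σ : V → Fin q) :
    μ.real (agree S σ) = ∑ τ : ↥(T : Set V) → Fin q,
      if glue T τ σ ∈ agree S σ then μ.real (agree (S ∪ T) (glue T τ σ)) else 0 := by
  have hU : agree S σ = ⋃ τ ∈ (Finset.univ : Finset (↥(T : Set V) → Fin q)).filter
      (fun τ => glue T τ σ ∈ agree S σ), agree (S ∪ T) (glue T τ σ) := by
    ext ω
    simp only [Finset.mem_filter, Finset.mem_univ, true_and, Set.mem_iUnion, exists_prop]
    constructor
    · intro h
      have hω : ∀ v, v ∈ S ∨ v ∈ T → ω v = glue T (fun v => ω v.1) σ v := fun v hv => by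
        by_cases hT : v ∈ T
        · rw [glue_of_mem _ _ (Finset.mem_coe.2 hT)]
        · rw [glue_of_notMem _ _ hT]
          exact h v (hv.resolve_right hT)
      refine ⟨fun v => ω v.1, fun v hv => ?_, fun v hv => hω v (Finset.mem_union.1 hv)⟩
      rw [← hω v (Or.inl hv), h v hv]
    · rintro ⟨τ, h, hω⟩ v hv
      rw [hω v (Finset.mem_union_left _ hv), h v hv]
  rw [← Finset.sum_filter, ← measureReal_biUnion_finset]
  · exact congrArg _ hU
  · intro τ _ τ' _ hne
    refine Set.disjoint_left.2 fun ω h h' => hne ?_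
    ext1 v
    have h1 := h v.1 (Finset.mem_union_right _ v.2)
    have h2 := h' v.1 (Finset.mem_union_right _ v.2)
    rw [glue_of_mem _ _ v.2] at h1 h2
    exact h1.symm.trans h2
  · exact fun τ _ => measurableSet_agree _ _

lemma measureReal_agree_eq_sum (μ : Measure (V → Fin q)) [IsFiniteMeasure μ]
    {S T : Finset V} (hST : Disjoint S T) (σ : V → Fin q) :
    μ.real (agree S σ) = ∑ τ : ↥(T : Set V) → Fin q, μ.real (agree (S ∪ T) (glue T τ σ)) := by
  classical
  rw [measureReal_agree_eq_sum_ite μ S T σ]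
  refine Finset.sum_congr rfl fun τ _ => if_pos fun v hv => ?_
  exact glue_of_notMem _ _ (Finset.disjoint_left.1 hST hv)

lemma sum_measureReal_agree_glue (μ : Measure (V → Fin q)) [IsProbabilityMeasure μ]
    (T : Finset V) (σ : V → Fin q) :
    ∑ τ : ↥(T : Set V) → Fin q, μ.real (agree T (glue T τ σ)) = 1 := by
  have h := measureReal_agree_eq_sum μ (Finset.disjoint_empty_left T) σ
  have h0 : agree ∅ σ = Set.univ := by ext; simp [agree]
  rw [h0, probReal_univ] at h
  simpa using h.symm

/-- A probability measure on configurations is determined by its values on cylinders over an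
exhausting family of finite sets. -/
lemma measure_eq_of_measureReal_agree {μ ν : Measure (V → Fin q)} [IsProbabilityMeasure μ]
    [IsProbabilityMeasure ν] {B : ℕ → Finset V} (hB : ∀ S : Finset V, ∃ n, S ⊆ B n)
    (h : ∀ n σ, μ.real (agree (B n) σ) = ν.real (agree (B n) σ)) : μ = ν := by
  have hS : ∀ (S : Finset V) (σ : V → Fin q), μ.real (agree S σ) = ν.real (agree S σ) := by
    intro S σ
    obtain ⟨n, hn⟩ := hB S
    rw [measureReal_agree_eq_sum μ (Finset.disjoint_sdiff (s := S) (t := B n)),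
      measureReal_agree_eq_sum ν (Finset.disjoint_sdiff (s := S) (t := B n)),
      Finset.union_sdiff_of_subset hn]
    exact Finset.sum_congr rfl fun τ _ => h n _
  have hmeas := fun I : Finset V => Finset.measurable_restrict (X := fun _ : V => Fin q) I
  have hproj : IsProjectiveLimit ν (fun I : Finset V => μ.map (Finset.restrict (π := fun _ : V => Fin q) I)) := by
    intro I
    refine Measure.ext_of_singleton fun τ => ?_
    rw [Measure.map_apply (hmeas I) (measurableSet_singleton τ),
      Measure.map_apply (hmeas I) (measurableSet_singleton τ)]
    rcases isEmpty_or_nonempty (V → Fin q) with he | ⟨⟨σ₀⟩⟩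
    · simp [Set.eq_empty_of_isEmpty]
    have e : Finset.restrict (π := fun _ : V => Fin q) I ⁻¹' {τ} = agree I (glue I τ σ₀) := by
      ext ω
      simp only [agree, Set.mem_preimage, Set.mem_singleton_iff, Set.mem_ofPred_eq]
      constructor
      · rintro rfl v hv
        rw [glue_of_mem _ _ (Finset.mem_coe.2 hv)]
        rfl
      · intro h
        ext1 v
        have := h v.1 v.2
        rwa [glue_of_mem _ _ v.2] at this
    rw [e, ← measureReal_eq_measureReal_iff]
    exact (hS I _).symm
  exact IsProjectiveLimit.unique (P := fun I : Finset V => μ.map (Finset.restrict (π := fun _ : V => Fin q) I)) (fun I => rfl) hproj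

end Cylinder

/-! ### The Gibbs specification on the tree -/

namespace TreeVertex
variable {Δ q : ℕ}

open Classical in
/-- The boundary `∂U` as a finite set. -/
noncomputable def boundary (U : Finset (TreeVertex Δ)) : Finset (TreeVertex Δ) :=
  {v ∈ U | v ∈ innerBoundary (regularTree Δ) U}

lemma mem_boundary {U : Finset (TreeVertex Δ)} {v : TreeVertex Δ} :
    v ∈ boundary U ↔ v ∈ innerBoundary (regularTree Δ) U := by
  simp only [boundary, Finset.mem_filter, and_iff_right_iff_imp]
  exact fun h => h.1

lemma boundary_subset (U : Finset (TreeVertex Δ)) : boundary U ⊆ U := by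
  classical exact Finset.filter_subset _ _

open Classical in
/-- The partition function of `U` with the boundary condition given by `ω`. -/
noncomputable def condZ (w : ℝ) (U : Finset (TreeVertex Δ)) (ω : TreeVertex Δ → Fin q) : ℝ :=
  ∑ τ : ↥(U : Set (TreeVertex Δ)) → Fin q,
    if glue U τ ω ∈ agree (boundary U) ω then treeWeight w U (glue U τ ω) else 0

lemma glue_congr {U : Finset (TreeVertex Δ)} (τ : ↥(U : Set (TreeVertex Δ)) → Fin q)
    (ω ω' : TreeVertex Δ → Fin q) {v : TreeVertex Δ} (hv : v ∈ U) :
    glue U τ ω v = glue U τ ω' v := by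
  rw [glue_of_mem _ _ (Finset.mem_coe.2 hv), glue_of_mem _ _ (Finset.mem_coe.2 hv)]

lemma condZ_congr {w : ℝ} {U : Finset (TreeVertex Δ)} {ω ω' : TreeVertex Δ → Fin q}
    (h : ∀ v ∈ boundary U, ω v = ω' v) : condZ w U ω = condZ w U ω' := by
  unfold condZ
  refine Finset.sum_congr rfl fun τ _ => ?_
  have e1 : glue U τ ω ∈ agree (boundary U) ω ↔ glue U τ ω' ∈ agree (boundary U) ω' :=
    forall₂_congr fun v hv => by rw [h v hv, glue_congr τ ω ω' (boundary_subset U hv)]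
  classical exact if_congr e1 (treeWeight_congr fun v hv => glue_congr τ ω ω' hv) rfl

lemma condZ_pos {w : ℝ} (hw : 0 < w) (U : Finset (TreeVertex Δ)) (ω : TreeVertex Δ → Fin q) :
    0 < condZ w U ω := by
  refine Finset.sum_pos' (fun τ _ => ?_) ⟨fun v => ω v.1, Finset.mem_univ _, ?_⟩
  · split_ifs
    exacts [(treeWeight_pos hw _ _).le, le_rfl]
  · rw [if_pos]
    · exact treeWeight_pos hw _ _
    · intro v hv
      rw [glue_of_mem _ _ (Finset.mem_coe.2 (boundary_subset U hv))]

open Classical in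
lemma pottsKernel_eq {w : ℝ} (hw : 0 < w) (U : Finset (TreeVertex Δ))
    (σ : ↥(U : Set (TreeVertex Δ)) → Fin q) (ω : TreeVertex Δ → Fin q) :
    pottsKernel (regularTree Δ) w U σ ω =
      if glue U σ ω ∈ agree (boundary U) ω then treeWeight w U (glue U σ ω) / condZ w U ω
      else 0 := by
  have hpow : ∀ τ : ↥(U : Set (TreeVertex Δ)) → Fin q,
      w ^ monoEdgeCount ((regularTree Δ).induce (U : Set (TreeVertex Δ))) τ
        = treeWeight w U (glue U τ ω) := fun τ => by
    rw [← pow_monoEdgeCount_eq]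
    congr 2
    ext1 v
    rw [glue_of_mem _ _ v.2]
  have hmem : ∀ τ : ↥(U : Set (TreeVertex Δ)) → Fin q,
      τ ∈ {τ : ↥(U : Set (TreeVertex Δ)) → Fin q | ∀ v : (U : Set (TreeVertex Δ)),
        v.1 ∈ innerBoundary (regularTree Δ) U → τ v = ω v.1}
      ↔ glue U τ ω ∈ agree (boundary U) ω := fun τ => by
    constructor
    · intro h v hv
      rw [glue_of_mem _ _ (Finset.mem_coe.2 (boundary_subset U hv))]
      exact h ⟨v, boundary_subset U hv⟩ (mem_boundary.1 hv)
    · intro h v hv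
      have := h v.1 (mem_boundary.2 hv)
      rwa [glue_of_mem _ _ v.2] at this
  have hZ : 0 < pottsZ ((regularTree Δ).induce (U : Set (TreeVertex Δ))) q w :=
    Finset.sum_pos (fun _ _ => pow_pos hw _) ⟨fun v => ω v.1, @Finset.mem_univ _ (_) _⟩
  have hPr : ∀ A : Set (↥(U : Set (TreeVertex Δ)) → Fin q),
      pottsPr ((regularTree Δ).induce (U : Set (TreeVertex Δ))) w A
        = (∑ τ : ↥(U : Set (TreeVertex Δ)) → Fin q,
            if τ ∈ A then treeWeight w U (glue U τ ω) else 0)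
          / pottsZ ((regularTree Δ).induce (U : Set (TreeVertex Δ))) q w := fun A => by
    unfold pottsPr
    rw [← Finset.sum_div, Finset.sum_filter]
    congr 1
    convert rfl using 3
    · exact (hpow _).symm
  unfold pottsKernel pottsCondPr
  rw [hPr, hPr, div_div_div_cancel_right₀ hZ.ne']
  simp only [Set.mem_inter_iff, Set.mem_singleton_iff, hmem]
  have hnum : (∑ τ : ↥(U : Set (TreeVertex Δ)) → Fin q,
      if τ = σ ∧ glue U τ ω ∈ agree (boundary U) ω then treeWeight w U (glue U τ ω) else 0)
      = if glue U σ ω ∈ agree (boundary U) ω then treeWeight w U (glue U σ ω) else 0 := by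
    rw [Finset.sum_eq_single σ]
    · simp
    · intro τ _ hne
      rw [if_neg fun h => hne h.1]
    · intro h
      exact absurd (Finset.mem_univ σ) h
  rw [hnum, ite_div, zero_div]
  congr

/-- The density of a Gibbs measure on `U` is the Potts weight times a function of the colours on
`∂U`. -/
lemma measureReal_agree_of_isPottsGibbs {w : ℝ} (hw : 0 < w)
    {μ : Measure (TreeVertex Δ → Fin q)} (hμ : IsPottsGibbs (regularTree Δ) q w μ)
    (U : Finset (TreeVertex Δ)) (σ : TreeVertex Δ → Fin q) :
    μ.real (agree U σ) =
      treeWeight w U σ * (μ.real (agree (boundary U) σ) / condZ w U σ) := by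
  classical
  have := hμ.isProbabilityMeasure
  have hE : {ω : TreeVertex Δ → Fin q | ∀ v : (U : Set (TreeVertex Δ)), ω v.1 = σ v.1}
      = agree U σ := by
    ext ω
    exact ⟨fun h v hv => h ⟨v, hv⟩, fun h v => h v.1 v.2⟩
  have h := hμ.condProb_eq U (fun v => σ v.1)
  rw [hE] at h
  have h1 := integral_congr_ae h
  rw [integral_condExp cylinderEvents_le_pi,
    integral_indicator_const _ (measurableSet_agree U σ)] at h1
  have hglue : ∀ ω : TreeVertex Δ → Fin q, ∀ v ∈ U,
      glue U (fun v : ↥(U : Set (TreeVertex Δ)) => σ v.1) ω v = σ v := fun ω v hv =>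
    glue_of_mem _ _ (Finset.mem_coe.2 hv)
  have hker : ∀ ω, pottsKernel (regularTree Δ) w U (fun v => σ v.1) ω
      = (agree (boundary U) σ).indicator (fun _ => treeWeight w U σ / condZ w U σ) ω := by
    intro ω
    rw [pottsKernel_eq hw]
    have hiff : glue U (fun v : ↥(U : Set (TreeVertex Δ)) => σ v.1) ω ∈ agree (boundary U) ω
        ↔ ω ∈ agree (boundary U) σ :=
      forall₂_congr fun v hv => by rw [hglue ω v (boundary_subset U hv), eq_comm]
    by_cases hω : ω ∈ agree (boundary U) σ
    · rw [if_pos (hiff.2 hω), Set.indicator_of_mem hω, treeWeight_congr (hglue ω),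
        condZ_congr hω]
    · rw [if_neg (fun h => hω (hiff.1 h)), Set.indicator_of_notMem hω]
  simp only [hker] at h1
  rw [integral_indicator_const _ (measurableSet_agree _ σ)] at h1
  simp only [smul_eq_mul, mul_one] at h1
  rw [h1]
  ring

end TreeVertex

/-! ### Marginals of a Gibbs measure as mixtures of message products -/

lemma sum_prod_glue {V : Type*} [DecidableEq V] {q : ℕ} (T : Finset V) (f : V → Fin q → ℝ)
    (σ : V → Fin q) :
    ∑ τ : ↥(T : Set V) → Fin q, ∏ v ∈ T, f v (glue T τ σ v) = ∏ v ∈ T, ∑ j, f v j := by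
  have h : ∀ g : V → ℝ, ∏ v ∈ T, g v = ∏ v : ↥(T : Set V), g v.1 := fun g =>
    (Finset.prod_coe_sort T g).symm
  simp only [h]
  rw [Finset.prod_univ_sum, Fintype.piFinset_univ]
  refine Finset.sum_congr rfl fun τ _ => Finset.prod_congr rfl fun v _ => ?_
  rw [glue_of_mem _ _ v.2]

namespace TreeVertex
variable {d q : ℕ}

/-- `F σ` is a nonnegative combination of terms in which the Potts weight on the ball of radius
`n` is multiplied by one message of generation `r` for every vertex of the sphere. -/
def IsMessageMixture (w : ℝ) (n r : ℕ) (F : (TreeVertex (d + 1) → Fin q) → ℝ) : Prop :=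
  ∃ (κ : Type) (_ : Fintype κ) (g : κ → ℝ) (h : κ → TreeVertex (d + 1) → Fin q → ℝ),
    (∀ k, 0 ≤ g k) ∧
    (∀ k, ∀ v ∈ layer (d + 1) n, h k v ∈ messages (Fin q) d ((1 - w) / q) r) ∧
    ∀ σ, F σ = ∑ k, g k *
      (treeWeight w (ball (d + 1) n) σ * ∏ v ∈ layer (d + 1) n, h k v (σ v))

/-- The Markov property on a ball: the mixture runs over the colourings `η` of the sphere, and the
messages are the point masses at the colours of `η`, scaled to have mean one. -/
lemma isMessageMixture_zero [NeZero q] {w : ℝ} (hw : 0 < w)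
    {μ : Measure (TreeVertex (d + 1) → Fin q)} (hμ : IsPottsGibbs (regularTree (d + 1)) q w μ)
    (n : ℕ) : IsMessageMixture w n 0 fun σ => μ.real (agree (ball (d + 1) n) σ) := by
  classical
  have hq0 : (q : ℝ) ≠ 0 := by exact_mod_cast NeZero.ne q
  let σ₀ : TreeVertex (d + 1) → Fin q := fun _ => 0
  let L := layer (d + 1) n
  let G : (TreeVertex (d + 1) → Fin q) → ℝ := fun σ =>
    μ.real (agree (boundary (ball (d + 1) n)) σ) / condZ w (ball (d + 1) n) σ
  have hG : ∀ σ τ : TreeVertex (d + 1) → Fin q, (∀ v ∈ L, σ v = τ v) → G σ = G τ := by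
    intro σ τ h
    have h' : ∀ v ∈ boundary (ball (d + 1) n), σ v = τ v := fun v hv =>
      h v (innerBoundary_ball_subset n (mem_boundary.1 hv))
    simp only [G]
    rw [agree_congr h', condZ_congr h']
  refine ⟨↥(L : Set (TreeVertex (d + 1))) → Fin q, inferInstance,
    fun η => G (glue L η σ₀) * (1 / (q : ℝ)) ^ L.card,
    fun η v i => if i = glue L η σ₀ v then (q : ℝ) else 0, fun η => ?_, fun η v _ => ⟨fun j => ?_, ?_⟩,
    fun σ => ?_⟩
  · exact mul_nonneg (div_nonneg measureReal_nonneg (condZ_pos hw _ _).le) (by positivity)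
  · dsimp only
    split_ifs <;> positivity
  · rw [Fintype.expect_eq_sum_div_card]
    simp [hq0]
  · rw [Finset.sum_eq_single fun v : ↥(L : Set (TreeVertex (d + 1))) => σ v.1]
    · have hg : ∀ v ∈ L, σ v = glue L (fun v : ↥(L : Set (TreeVertex (d + 1))) => σ v.1) σ₀ v :=
        fun v hv => by rw [glue_of_mem _ _ (Finset.mem_coe.2 hv)]
      have h1 : ∏ v ∈ L, (if σ v = glue L (fun v : ↥(L : Set (TreeVertex (d + 1))) => σ v.1) σ₀ v
          then (q : ℝ) else 0) = (q : ℝ) ^ L.card := by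
        rw [← Finset.prod_const]
        exact Finset.prod_congr rfl fun v hv => if_pos (hg v hv)
      dsimp only
      rw [h1, ← hG _ _ hg, measureReal_agree_of_isPottsGibbs hw hμ]
      have : (1 / (q : ℝ)) ^ L.card * (q : ℝ) ^ L.card = 1 := by
        rw [← mul_pow, one_div_mul_cancel hq0, one_pow]
      calc _ = treeWeight w (ball (d + 1) n) σ * G σ * 1 := by simp only [G, mul_one]
        _ = treeWeight w (ball (d + 1) n) σ * G σ * ((1 / (q : ℝ)) ^ L.card * (q : ℝ) ^ L.card) := by
          rw [this]
        _ = _ := by ring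
    · intro η _ hη
      obtain ⟨v, hv⟩ := Function.ne_iff.1 hη
      have : ∏ v ∈ L, (if σ v = glue L η σ₀ v then (q : ℝ) else 0) = 0 := by
        refine Finset.prod_eq_zero (i := v.1) v.2 (if_neg ?_)
        rw [glue_of_mem _ _ v.2]
        exact fun h => hv h.symm
      rw [this]
      ring
    · exact fun h => absurd (Finset.mem_univ _) h

lemma sum_edgeWeight_mul [NeZero q] (w : ℝ) {h : Fin q → ℝ} (h1 : 𝔼 j, h j = 1) (i : Fin q) :
    ∑ j, edgeWeight w j i * h j = q * (1 - (1 - w) / q * h i) := by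
  have hq0 : (q : ℝ) ≠ 0 := by exact_mod_cast NeZero.ne q
  have hs : ∑ j, h j = q := by
    rw [← Fintype.card_mul_expect, h1, Fintype.card_fin, mul_one]
  have : ∀ j, edgeWeight w j i * h j = h j - if j = i then (1 - w) * h j else 0 := fun j => by
    unfold edgeWeight; split_ifs <;> ring
  simp only [this, Finset.sum_sub_distrib, hs, Finset.sum_ite_eq', Finset.mem_univ, if_true]
  field_simp

lemma parent_child {Δ : ℕ} {u : TreeVertex Δ} {a : Fin Δ} (h : a ∈ childLetters u) :
    parent (child u a) = u :=
  word_injective (by rw [word_parent, child_val h, List.tail_cons])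

/-- Summing over the colours on the outermost sphere replaces its messages by those of the next
generation. -/
lemma IsMessageMixture.step [NeZero q] {w : ℝ} (hw1 : w < 1)
    (hθ : (1 - w) / q * ((d : ℝ) + 1) ≤ 1) (hdq : 100000 + 101 * q ≤ d) {n r : ℕ} (hn : 1 ≤ n)
    {F F' : (TreeVertex (d + 1) → Fin q) → ℝ} (hF : IsMessageMixture w (n + 1) r F)
    (hF' : ∀ σ, F' σ = ∑ τ : ↥(layer (d + 1) (n + 1) : Set (TreeVertex (d + 1))) → Fin q,
      F (glue (layer (d + 1) (n + 1)) τ σ)) : IsMessageMixture w n (r + 1) F' := by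
  have hq : (0 : ℝ) < q := by exact_mod_cast NeZero.pos q
  have hθ0 : 0 < (1 - w) / q := div_pos (by linarith) hq
  obtain ⟨κ, _, g, h, hg, hh, hFσ⟩ := hF
  have hmsg := fun k v hv => messages_nonneg_expect hθ0 hθ (by rwa [Fintype.card_fin]) (hh k v hv)
  have hchild : ∀ u ∈ layer (d + 1) n, ∀ a ∈ childLetters u,
      child u a ∈ layer (d + 1) (n + 1) := fun u hu a ha => by
    rw [mem_layer] at hu ⊢
    rw [child_val ha, List.length_cons, hu]
  let R : κ → TreeVertex (d + 1) → Fin q → ℝ := fun k u i =>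
    ∏ a ∈ childLetters u, (1 - (1 - w) / q * h k (child u a) i)
  have hR : ∀ k, ∀ u ∈ layer (d + 1) n, ∀ i, 0 < R k u i := fun k u hu i =>
    Finset.prod_pos fun a ha => (hmsg k _ (hchild u hu a ha)).2.2 i
  have hER : ∀ k, ∀ u ∈ layer (d + 1) n, 0 < 𝔼 i, R k u i := fun k u hu =>
    Finset.expect_pos (fun i _ => hR k u hu i) Finset.univ_nonempty
  refine ⟨κ, inferInstance,
    fun k => g k * ∏ u ∈ layer (d + 1) n, ((q : ℝ) ^ (childLetters u).card * 𝔼 i, R k u i),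
    fun k u i => (𝔼 i, R k u i)⁻¹ * R k u i, fun k => ?_, fun k u hu => ⟨?_, ?_⟩, fun σ => ?_⟩
  · exact mul_nonneg (hg k) (Finset.prod_nonneg fun u hu =>
      mul_nonneg (by positivity) (hER k u hu).le)
  · rw [← Finset.mul_expect, inv_mul_cancel₀ (hER k u hu).ne']
  · refine ⟨childLetters u, fun a => h k (child u a), (𝔼 i, R k u i)⁻¹,
      inv_pos.2 (hER k u hu), ?_, fun a ha => hh k _ (hchild u hu a ha), fun j => rfl⟩
    rw [card_childLetters, Nat.add_sub_cancel]
    rw [mem_layer] at hu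
    intro h0
    rw [h0] at hu
    simp at hu
    omega
  · rw [hF' σ]
    simp only [hFσ]
    rw [Finset.sum_comm]
    refine Finset.sum_congr rfl fun k _ => ?_
    rw [← Finset.mul_sum, mul_assoc]
    congr 1
    have hball : ∀ (τ : ↥(layer (d + 1) (n + 1) : Set (TreeVertex (d + 1))) → Fin q),
        ∀ v ∈ ball (d + 1) n, glue (layer (d + 1) (n + 1)) τ σ v = σ v := fun τ v hv =>
      glue_of_notMem _ _ (Finset.disjoint_left.1 (disjoint_ball_layer n) hv)
    have hpar : ∀ v ∈ layer (d + 1) (n + 1), parent v ∈ ball (d + 1) n := fun v hv => by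
      rw [mem_layer] at hv
      rw [mem_ball, length_parent, hv]
      omega
    have hterm : ∀ τ : ↥(layer (d + 1) (n + 1) : Set (TreeVertex (d + 1))) → Fin q,
        treeWeight w (ball (d + 1) (n + 1)) (glue (layer (d + 1) (n + 1)) τ σ) *
          ∏ v ∈ layer (d + 1) (n + 1), h k v (glue (layer (d + 1) (n + 1)) τ σ v)
        = treeWeight w (ball (d + 1) n) σ * ∏ v ∈ layer (d + 1) (n + 1),
          (edgeWeight w (glue (layer (d + 1) (n + 1)) τ σ v) (σ (parent v)) *
            h k v (glue (layer (d + 1) (n + 1)) τ σ v)) := fun τ => by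
      rw [treeWeight_ball_succ, treeWeight_congr (hball τ), mul_assoc,
        ← Finset.prod_mul_distrib]
      congr 1
      exact Finset.prod_congr rfl fun v hv => by rw [hball τ _ (hpar v hv)]
    simp only [hterm]
    rw [← Finset.mul_sum, sum_prod_glue _ (fun v j => edgeWeight w j (σ (parent v)) * h k v j) σ,
      mul_left_comm]
    congr 1
    have hsum : ∀ v ∈ layer (d + 1) (n + 1), ∑ j, edgeWeight w j (σ (parent v)) * h k v j
        = q * (1 - (1 - w) / q * h k v (σ (parent v))) := fun v hv =>
      sum_edgeWeight_mul w (hmsg k v hv).2.1 _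
    rw [Finset.prod_congr rfl hsum, prod_layer_succ, ← Finset.prod_mul_distrib]
    refine Finset.prod_congr rfl fun u hu => ?_
    have hER' := (hER k u hu).ne'
    calc _ = ∏ a ∈ childLetters u, ((q : ℝ) * (1 - (1 - w) / q * h k (child u a) (σ u))) :=
          Finset.prod_congr rfl fun a ha => by rw [parent_child ha]
      _ = (q : ℝ) ^ (childLetters u).card * R k u (σ u) := by
          rw [Finset.prod_mul_distrib, Finset.prod_const]
      _ = _ := by field_simp

lemma isMessageMixture_of_isPottsGibbs [NeZero q] {w : ℝ} (hw : 0 < w) (hw1 : w < 1)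
    (hθ : (1 - w) / q * ((d : ℝ) + 1) ≤ 1) (hdq : 100000 + 101 * q ≤ d)
    {μ : Measure (TreeVertex (d + 1) → Fin q)} (hμ : IsPottsGibbs (regularTree (d + 1)) q w μ)
    (r : ℕ) : ∀ n, 1 ≤ n →
      IsMessageMixture w n r fun σ => μ.real (agree (ball (d + 1) n) σ) := by
  have := hμ.isProbabilityMeasure
  induction r with
  | zero => exact fun n _ => isMessageMixture_zero hw hμ n
  | succ r ih =>
    intro n hn
    refine (ih (n + 1) (by omega)).step hw1 hθ hdq hn fun σ => ?_
    rw [measureReal_agree_eq_sum μ (disjoint_ball_layer n) σ, ball_succ]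

/-- If the messages can be taken arbitrarily close to uniform, then only the Potts weight of the
ball remains. -/
lemma mul_treeWeight_le_of_isMessageMixture [NeZero q] {w : ℝ} (hw : 0 < w) (hw1 : w < 1)
    (hθ : (1 - w) / q * ((d : ℝ) + 1) ≤ 1) (hdq : 100000 + 101 * q ≤ d) {n : ℕ}
    {F : (TreeVertex (d + 1) → Fin q) → ℝ} (hF : ∀ r, IsMessageMixture w n r F)
    (σ τ : TreeVertex (d + 1) → Fin q) :
    F σ * treeWeight w (ball (d + 1) n) τ ≤ F τ * treeWeight w (ball (d + 1) n) σ := by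
  have hq : (0 : ℝ) < q := by exact_mod_cast NeZero.pos q
  have hθ0 : 0 < (1 - w) / q := div_pos (by linarith) hq
  have hTσ := treeWeight_pos hw (ball (d + 1) n) σ
  have hTτ := treeWeight_pos hw (ball (d + 1) n) τ
  set N := (layer (d + 1) n).card
  have key : ∀ ε : ℝ, 0 < ε → ε < 1 →
      (1 - ε) ^ N * (F σ * treeWeight w (ball (d + 1) n) τ)
        ≤ (1 + ε) ^ N * (F τ * treeWeight w (ball (d + 1) n) σ) := by
    intro ε hε hε1
    obtain ⟨r, hr⟩ := exists_messages_near_one (ι := Fin q) hθ0 hθ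
      (by rwa [Fintype.card_fin]) hε
    obtain ⟨κ, _, g, h, hg, hh, hFσ⟩ := hF r
    have hup : ∀ k, ∀ σ : TreeVertex (d + 1) → Fin q,
        ∏ v ∈ layer (d + 1) n, h k v (σ v) ≤ (1 + ε) ^ N := fun k σ => by
      rw [← Finset.prod_const]
      refine Finset.prod_le_prod (fun v hv => ?_) (fun v hv => ?_)
      · linarith [(abs_le.1 (hr _ (hh k v hv) (σ v))).1]
      · linarith [(abs_le.1 (hr _ (hh k v hv) (σ v))).2]
    have hlo : ∀ k, ∀ σ : TreeVertex (d + 1) → Fin q,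
        (1 - ε) ^ N ≤ ∏ v ∈ layer (d + 1) n, h k v (σ v) := fun k σ => by
      rw [← Finset.prod_const]
      refine Finset.prod_le_prod (fun v hv => by linarith) (fun v hv => ?_)
      linarith [(abs_le.1 (hr _ (hh k v hv) (σ v))).1]
    have h1 : F σ ≤ (∑ k, g k) * (treeWeight w (ball (d + 1) n) σ * (1 + ε) ^ N) := by
      rw [hFσ, Finset.sum_mul]
      exact Finset.sum_le_sum fun k _ => mul_le_mul_of_nonneg_left
        (mul_le_mul_of_nonneg_left (hup k σ) hTσ.le) (hg k)
    have h2 : (∑ k, g k) * (treeWeight w (ball (d + 1) n) τ * (1 - ε) ^ N) ≤ F τ := by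
      rw [hFσ τ, Finset.sum_mul]
      exact Finset.sum_le_sum fun k _ => mul_le_mul_of_nonneg_left
        (mul_le_mul_of_nonneg_left (hlo k τ) hTτ.le) (hg k)
    have hε' : 0 ≤ 1 - ε := by linarith
    calc _ ≤ (1 - ε) ^ N * (((∑ k, g k) * (treeWeight w (ball (d + 1) n) σ * (1 + ε) ^ N))
            * treeWeight w (ball (d + 1) n) τ) := by gcongr
      _ = (1 + ε) ^ N * (((∑ k, g k) * (treeWeight w (ball (d + 1) n) τ * (1 - ε) ^ N))
            * treeWeight w (ball (d + 1) n) σ) := by ring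
      _ ≤ _ := by gcongr
  have hlim : ∀ s : ℝ, ∀ x : ℝ, Filter.Tendsto (fun ε : ℝ => (1 + s * ε) ^ N * x)
      (nhdsWithin 0 (Set.Ioi 0)) (nhds x) := fun s x => by
    have : Continuous fun ε : ℝ => (1 + s * ε) ^ N * x := by fun_prop
    have h := this.tendsto 0
    simp only [mul_zero, add_zero, one_pow, one_mul] at h
    exact h.mono_left nhdsWithin_le_nhds
  refine le_of_tendsto_of_tendsto (hlim (-1) _) (hlim 1 _) ?_
  filter_upwards [Ioo_mem_nhdsGT (zero_lt_one' ℝ)] with ε hε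
  have := key ε hε.1 hε.2
  simpa [sub_eq_add_neg] using this

/-- Every Gibbs measure has the marginals of the free Potts model on balls. -/
lemma measureReal_agree_ball_of_isPottsGibbs [NeZero q] {w : ℝ} (hw : 0 < w) (hw1 : w < 1)
    (hθ : (1 - w) / q * ((d : ℝ) + 1) ≤ 1) (hdq : 100000 + 101 * q ≤ d)
    {μ : Measure (TreeVertex (d + 1) → Fin q)} (hμ : IsPottsGibbs (regularTree (d + 1)) q w μ)
    {n : ℕ} (hn : 1 ≤ n) (σ : TreeVertex (d + 1) → Fin q) :
    μ.real (agree (ball (d + 1) n) σ) = treeWeight w (ball (d + 1) n) σ /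
      ∑ τ : ↥(ball (d + 1) n : Set (TreeVertex (d + 1))) → Fin q,
        treeWeight w (ball (d + 1) n) (glue (ball (d + 1) n) τ σ) := by
  have := hμ.isProbabilityMeasure
  have hmix := fun r => isMessageMixture_of_isPottsGibbs hw hw1 hθ hdq hμ r n hn
  have heq : ∀ τ, μ.real (agree (ball (d + 1) n) σ) * treeWeight w (ball (d + 1) n) τ
      = μ.real (agree (ball (d + 1) n) τ) * treeWeight w (ball (d + 1) n) σ := fun τ =>
    le_antisymm (mul_treeWeight_le_of_isMessageMixture hw hw1 hθ hdq hmix σ τ)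
      (mul_treeWeight_le_of_isMessageMixture hw hw1 hθ hdq hmix τ σ)
  rw [eq_div_iff, Finset.mul_sum]
  · simp only [heq]
    rw [← Finset.sum_mul, sum_measureReal_agree_glue, one_mul]
  · exact (Finset.sum_pos (fun _ _ => treeWeight_pos hw _ _)
      ⟨fun v => σ v.1, Finset.mem_univ _⟩).ne'

theorem isPottsGibbs_unique [NeZero q] {w : ℝ} (hw : 0 < w) (hw1 : w < 1)
    (hθ : (1 - w) / q * ((d : ℝ) + 1) ≤ 1) (hdq : 100000 + 101 * q ≤ d)
    {μ ν : Measure (TreeVertex (d + 1) → Fin q)}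
    (hμ : IsPottsGibbs (regularTree (d + 1)) q w μ)
    (hν : IsPottsGibbs (regularTree (d + 1)) q w ν) : μ = ν := by
  have := hμ.isProbabilityMeasure
  have := hν.isProbabilityMeasure
  refine measure_eq_of_measureReal_agree (B := fun n => ball (d + 1) (n + 1)) (fun S => ?_)
    fun n σ => ?_
  · obtain ⟨n, hn, hS⟩ := exists_subset_ball S
    exact ⟨n - 1, by simpa only [Nat.sub_add_cancel hn] using hS⟩
  · rw [measureReal_agree_ball_of_isPottsGibbs hw hw1 hθ hdq hμ (by omega),
      measureReal_agree_ball_of_isPottsGibbs hw hw1 hθ hdq hν (by omega)]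

end TreeVertex

/-! ### Measures with the marginals of the free Potts model -/

section Cylinder
variable {V : Type*} {q : ℕ}

lemma measurableSet_cylinderEvents_agree {S : Set V} {T : Finset V} (hT : (T : Set V) ⊆ S)
    (σ : V → Fin q) : MeasurableSet[cylinderEvents (X := fun _ : V => Fin q) S] (agree T σ) := by
  have : agree T σ = ⋂ v ∈ T, (fun ω : V → Fin q => ω v) ⁻¹' {σ v} := by
    ext ω; simp [agree]
  rw [this]
  refine Finset.measurableSet_biInter _ fun v hv => ?_
  exact measurable_cylinderEvent_apply (X := fun _ : V => Fin q) (hT hv) (measurableSet_singleton _)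

variable [DecidableEq V]

/-- The events that prescribe the colours on `B n` outside `I` generate the sigma algebra of the
coordinates outside `I`. -/
lemma cylinderEvents_compl_eq_generateFrom [NeZero q] {B : ℕ → Finset V} {I : Finset V} {U : Finset V}
    (hB : ∀ S : Finset V, ∃ n, S ⊆ B n) :
    cylinderEvents (X := fun _ : V => Fin q) (I : Set V)ᶜ
      = MeasurableSpace.generateFrom
        {A | ∃ n, ∃ η : V → Fin q, U ⊆ B n ∧ A = agree (B n \ I) η} := by
  apply le_antisymm
  · refine iSup₂_le fun v hv => ?_
    rintro _ ⟨s, -, rfl⟩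
    obtain ⟨n, hn⟩ := hB (insert v U)
    have hvn : v ∈ B n \ I := Finset.mem_sdiff.2
      ⟨hn (Finset.mem_insert_self v U), hv⟩
    have e : (fun ω : V → Fin q => ω v) ⁻¹' s
        = ⋃ τ ∈ {τ : ↥((B n \ I : Finset V) : Set V) → Fin q | τ ⟨v, hvn⟩ ∈ s},
          agree (B n \ I) (glue (B n \ I) τ fun _ => 0) := by
      ext ω
      simp only [Set.mem_preimage, Set.mem_iUnion, exists_prop, Set.mem_ofPred_eq]
      constructor
      · intro h
        refine ⟨fun v => ω v.1, h, fun u hu => ?_⟩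
        rw [glue_of_mem _ _ (Finset.mem_coe.2 hu)]
      · rintro ⟨τ, h, hω⟩
        rw [hω v hvn, glue_of_mem _ _ (Finset.mem_coe.2 hvn)]
        exact h
    rw [e]
    refine MeasurableSet.biUnion (Set.to_countable _) fun τ _ => ?_
    exact MeasurableSpace.measurableSet_generateFrom
      ⟨n, _, (Finset.subset_insert v U).trans hn, rfl⟩
  · refine MeasurableSpace.generateFrom_le ?_
    rintro _ ⟨n, η, -, rfl⟩
    exact measurableSet_cylinderEvents_agree (fun v hv => (Finset.mem_sdiff.1 hv).2) η

lemma isPiSystem_agree_sdiff {B : ℕ → Finset V} (hmono : Monotone B) (I U : Finset V) :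
    IsPiSystem {A : Set (V → Fin q) | ∃ n, ∃ η : V → Fin q, U ⊆ B n ∧ A = agree (B n \ I) η} := by
  have key : ∀ (n m : ℕ) (η η' : V → Fin q), n ≤ m →
      (agree (B n \ I) η ∩ agree (B m \ I) η').Nonempty →
      agree (B n \ I) η ∩ agree (B m \ I) η' = agree (B m \ I) η' := by
    rintro n m η η' hnm ⟨ω, h1, h2⟩
    refine Set.inter_eq_right.2 fun ω' h v hv => ?_
    have hv' := Finset.sdiff_subset_sdiff (hmono hnm) le_rfl hv
    rw [h v hv', ← h2 v hv', h1 v hv]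
  rintro _ ⟨n, η, hn, rfl⟩ _ ⟨m, η', hm, rfl⟩ hne
  rcases le_total n m with h | h
  · rw [key n m η η' h hne]
    exact ⟨m, η', hm, rfl⟩
  · rw [Set.inter_comm] at hne ⊢
    rw [key m n η' η h hne]
    exact ⟨n, η, hn, rfl⟩

end Cylinder

namespace TreeVertex
variable {Δ q : ℕ}

lemma ball_mono : Monotone (ball Δ) := fun n m h v hv => by
  rw [mem_ball] at hv ⊢; omega

lemma innerEdges_mono {S T : Finset (TreeVertex Δ)} (h : S ⊆ T) : innerEdges S ⊆ innerEdges T := by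
  intro v hv
  simp only [innerEdges, Finset.mem_filter] at hv ⊢
  exact ⟨h hv.1, hv.2.1, h hv.2.2⟩

lemma mem_of_adj_of_mem_interior {U : Finset (TreeVertex Δ)} {u v : TreeVertex Δ}
    (hu : u ∈ U \ boundary U) (h : (regularTree Δ).Adj u v) : v ∈ U := by
  by_contra hv
  rw [Finset.mem_sdiff, mem_boundary] at hu
  exact hu.2 ⟨hu.1, v, hv, h⟩

/-- Edges that are not inside `U` do not meet the interior of `U`. -/
lemma notMem_interior_of_mem_innerEdges {U B : Finset (TreeVertex Δ)} {v : TreeVertex Δ}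
    (hv : v ∈ innerEdges B \ innerEdges U) :
    v ∈ B \ (U \ boundary U) ∧ parent v ∈ B \ (U \ boundary U) := by
  simp only [innerEdges, Finset.mem_sdiff, Finset.mem_filter] at hv
  obtain ⟨⟨h1, h2, h3⟩, h4⟩ := hv
  have hadj : (regularTree Δ).Adj v (parent v) := adj_iff.2 (Or.inl ⟨h2, rfl⟩)
  refine ⟨Finset.mem_sdiff.2 ⟨h1, fun h => h4 ⟨?_, h2, ?_⟩⟩,
    Finset.mem_sdiff.2 ⟨h3, fun h => h4 ⟨?_, h2, ?_⟩⟩⟩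
  · exact (Finset.mem_sdiff.1 h).1
  · exact mem_of_adj_of_mem_interior h hadj
  · exact mem_of_adj_of_mem_interior h hadj.symm
  · exact (Finset.mem_sdiff.1 h).1

/-- The spatial Markov property for one outer configuration `η`. -/
lemma measureReal_agree_glue {w : ℝ} (hw : 0 < w) {ν : Measure (TreeVertex Δ → Fin q)}
    [IsProbabilityMeasure ν] {U B : Finset (TreeVertex Δ)} (hU : U ⊆ B) {c : ℝ}
    (hν : ∀ σ, ν.real (agree B σ) = c * treeWeight w B σ)
    (σ : ↥(U : Set (TreeVertex Δ)) → Fin q) {η : TreeVertex Δ → Fin q}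
    (hη : glue U σ η ∈ agree (boundary U) η) :
    ν.real (agree B (glue U σ η)) = treeWeight w U (glue U σ η) / condZ w U η *
      ν.real (agree (B \ (U \ boundary U)) η) := by
  classical
  have hmem : ∀ τ : ↥(U : Set (TreeVertex Δ)) → Fin q,
      glue U τ η ∈ agree (B \ (U \ boundary U)) η ↔ glue U τ η ∈ agree (boundary U) η := by
    intro τ
    constructor
    · intro h v hv
      exact h v (Finset.mem_sdiff.2 ⟨hU (boundary_subset U hv), fun h => (Finset.mem_sdiff.1 h).2 hv⟩)
    · intro h v hv
      by_cases hvU : v ∈ U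
      · refine h v ?_
        by_contra hb
        exact (Finset.mem_sdiff.1 hv).2 (Finset.mem_sdiff.2 ⟨hvU, hb⟩)
      · exact glue_of_notMem _ _ hvU
  have hunion : B \ (U \ boundary U) ∪ U = B := by
    ext v
    simp only [Finset.mem_union, Finset.mem_sdiff]
    constructor
    · rintro (h | h)
      exacts [h.1, hU h]
    · intro h
      by_cases hvU : v ∈ U
      · exact Or.inr hvU
      · exact Or.inl ⟨h, fun h' => hvU h'.1⟩
  let R := ∏ v ∈ innerEdges B \ innerEdges U, edgeWeight w (η v) (η (parent v))
  have hsplit : ∀ τ : ↥(U : Set (TreeVertex Δ)) → Fin q, glue U τ η ∈ agree (boundary U) η →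
      treeWeight w B (glue U τ η) = R * treeWeight w U (glue U τ η) := by
    intro τ hτ
    have hτ' := (hmem τ).2 hτ
    unfold treeWeight
    rw [← Finset.prod_sdiff (innerEdges_mono hU)]
    congr 1
    refine Finset.prod_congr rfl fun v hv => ?_
    obtain ⟨h1, h2⟩ := notMem_interior_of_mem_innerEdges hv
    rw [hτ' v h1, hτ' _ h2]
  have hsum : ν.real (agree (B \ (U \ boundary U)) η) = c * R * condZ w U η := by
    rw [measureReal_agree_eq_sum_ite ν _ U η, hunion, condZ, Finset.mul_sum]
    refine Finset.sum_congr rfl fun τ _ => ?_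
    by_cases h : glue U τ η ∈ agree (boundary U) η
    · rw [if_pos ((hmem τ).2 h), if_pos h, hν, hsplit τ h]
      ring
    · rw [if_neg (fun h' => h ((hmem τ).1 h')), if_neg h, mul_zero]
  have hZ := (condZ_pos hw U η).ne'
  rw [hsum, hν, hsplit σ hη]
  field_simp

/-- A measure whose marginals on balls are proportional to the Potts weight is a Gibbs measure. The
identity of conditional probabilities is checked on the events that prescribe the colours of a ball
outside the interior of `U`, where it is `measureReal_agree_glue`. -/
lemma isPottsGibbs_of_treeWeight [NeZero q] {w : ℝ} (hw : 0 < w)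
    {ν : Measure (TreeVertex Δ → Fin q)} [IsProbabilityMeasure ν]
    (hν : ∀ n, ∃ c : ℝ, ∀ σ, ν.real (agree (ball Δ n) σ) = c * treeWeight w (ball Δ n) σ) :
    IsPottsGibbs (regularTree Δ) q w ν := by
  classical
  refine ⟨inferInstance, fun U σ => ?_⟩
  let I := U \ boundary U
  have hI : graphInterior (regularTree Δ) U = (I : Set (TreeVertex Δ)) := by
    ext v
    simp only [graphInterior, I, Finset.coe_sdiff, Set.mem_sdiff, Finset.mem_coe, mem_boundary]
  rw [hI]
  let ζ := glue U σ fun _ => 0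
  have hζ : ∀ ω : TreeVertex Δ → Fin q, ∀ v ∈ U, glue U σ ω v = ζ v := fun ω v hv =>
    glue_congr σ _ _ hv
  have hE : {ω : TreeVertex Δ → Fin q | ∀ v : (U : Set (TreeVertex Δ)), ω v.1 = σ v}
      = agree U ζ := by
    ext ω
    constructor
    · intro h v hv
      rw [← hζ ω v hv, glue_of_mem _ _ (Finset.mem_coe.2 hv)]
      exact h ⟨v, hv⟩
    · intro h v
      rw [h v.1 v.2, ← hζ ω v.1 v.2, glue_of_mem _ _ v.2]
  rw [hE]
  let K := treeWeight w U ζ / condZ w U ζ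
  have hK : 0 ≤ K := div_nonneg (treeWeight_pos hw _ _).le (condZ_pos hw _ _).le
  have hiff : ∀ ω : TreeVertex Δ → Fin q, glue U σ ω ∈ agree (boundary U) ω
      ↔ ω ∈ agree (boundary U) ζ := fun ω =>
    forall₂_congr fun v hv => by rw [hζ ω v (boundary_subset U hv), eq_comm]
  have hval : ∀ ω ∈ agree (boundary U) ζ, treeWeight w U (glue U σ ω) / condZ w U ω = K :=
    fun ω hω => by rw [treeWeight_congr (hζ ω), condZ_congr hω]
  have hker : pottsKernel (regularTree Δ) w U σ
      = (agree (boundary U) ζ).indicator fun _ => K := by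
    ext ω
    rw [pottsKernel_eq hw]
    by_cases hω : ω ∈ agree (boundary U) ζ
    · rw [if_pos ((hiff ω).2 hω), Set.indicator_of_mem hω, hval ω hω]
    · rw [if_neg (fun h => hω ((hiff ω).1 h)), Set.indicator_of_notMem hω]
  rw [hker]
  have hbI : ((boundary U : Finset (TreeVertex Δ)) : Set (TreeVertex Δ)) ⊆ (I : Set (TreeVertex Δ))ᶜ :=
    fun v hv h => (Finset.mem_sdiff.1 h).2 hv
  have hkey : ∀ A, MeasurableSet[cylinderEvents (X := fun _ : TreeVertex Δ => Fin q)
      (I : Set (TreeVertex Δ))ᶜ] A →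
      (ν.restrict (agree U ζ)) A = (ENNReal.ofReal K • ν.restrict (agree (boundary U) ζ)) A := by
    have hfin : IsFiniteMeasure (ENNReal.ofReal K • ν.restrict (agree (boundary U) ζ)) :=
      Measure.smul_finite _ ENNReal.ofReal_ne_top
    -- it suffices to consider the events that prescribe all colours of a ball outside `I`
    have hC : ∀ A ∈ {A : Set (TreeVertex Δ → Fin q) | ∃ n, ∃ η : TreeVertex Δ → Fin q,
        U ⊆ ball Δ n ∧ A = agree (ball Δ n \ I) η},
        (ν.restrict (agree U ζ)) A = (ENNReal.ofReal K • ν.restrict (agree (boundary U) ζ)) A := by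
      rintro _ ⟨n, η, hn, rfl⟩
      obtain ⟨c, hc⟩ := hν n
      have hbW : ∀ v ∈ boundary U, v ∈ ball Δ n \ I := fun v hv =>
        Finset.mem_sdiff.2 ⟨hn (boundary_subset U hv), hbI hv⟩
      rw [Measure.smul_apply, Measure.restrict_apply (measurableSet_agree _ _),
        Measure.restrict_apply (measurableSet_agree _ _), smul_eq_mul]
      by_cases hη : η ∈ agree (boundary U) ζ
      · have e1 : agree (ball Δ n \ I) η ∩ agree U ζ = agree (ball Δ n) (glue U σ η) := by
          ext ω
          constructor
          · rintro ⟨h1, h2⟩ v hv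
            by_cases hvU : v ∈ U
            · rw [hζ η v hvU]; exact h2 v hvU
            · rw [glue_of_notMem _ _ hvU]
              exact h1 v (Finset.mem_sdiff.2 ⟨hv, fun h => hvU (Finset.mem_sdiff.1 h).1⟩)
          · intro h
            refine ⟨fun v hv => ?_, fun v hv => ?_⟩
            · rw [h v (Finset.mem_sdiff.1 hv).1]
              by_cases hvU : v ∈ U
              · have hvb : v ∈ boundary U := by
                  by_contra hb
                  exact (Finset.mem_sdiff.1 hv).2 (Finset.mem_sdiff.2 ⟨hvU, hb⟩)
                rw [hζ η v hvU, hη v hvb]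
              · rw [glue_of_notMem _ _ hvU]
            · rw [h v (hn hv), hζ η v hv]
        have e2 : agree (ball Δ n \ I) η ∩ agree (boundary U) ζ = agree (ball Δ n \ I) η := by
          refine Set.inter_eq_left.2 fun ω h v hv => ?_
          rw [h v (hbW v hv), hη v hv]
        rw [e1, e2, ← ofReal_measureReal, ← ofReal_measureReal, ← ENNReal.ofReal_mul hK,
          measureReal_agree_glue hw hn hc σ ((hiff η).2 hη), hval η hη]
      · have e1 : agree (ball Δ n \ I) η ∩ agree (boundary U) ζ = ∅ := by
          refine Set.eq_empty_of_forall_notMem fun ω h => hη fun v hv => ?_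
          rw [← h.1 v (hbW v hv), h.2 v hv]
        have e2 : agree (ball Δ n \ I) η ∩ agree U ζ = ∅ := by
          refine Set.eq_empty_of_forall_notMem fun ω h => hη fun v hv => ?_
          rw [← h.1 v (hbW v hv), h.2 v (boundary_subset U hv)]
        rw [e1, e2, measure_empty, mul_zero]
    have hgen := cylinderEvents_compl_eq_generateFrom (q := q) (B := ball Δ) (I := I) (U := U)
      fun S => (exists_subset_ball S).imp fun n h => h.2
    have huniv : (ν.restrict (agree U ζ)) Set.univ
        = (ENNReal.ofReal K • ν.restrict (agree (boundary U) ζ)) Set.univ := by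
      obtain ⟨n, -, hn⟩ := exists_subset_ball U
      have h0 : agree ∅ ζ = Set.univ := by ext; simp [agree]
      rw [← h0, ← measureReal_eq_measureReal_iff]
      rw [measureReal_agree_eq_sum _ (Finset.disjoint_empty_left (ball Δ n \ I)),
        measureReal_agree_eq_sum _ (Finset.disjoint_empty_left (ball Δ n \ I)),
        Finset.empty_union]
      refine Finset.sum_congr rfl fun τ _ => ?_
      exact congrArg ENNReal.toReal (hC _ ⟨n, _, hn, rfl⟩)
    intro A hA
    exact ext_on_measurableSpace_of_generate_finite _ _ hC cylinderEvents_le_pi hgen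
      (isPiSystem_agree_sdiff ball_mono I U) huniv hA
  symm
  refine ae_eq_condExp_of_forall_setIntegral_eq cylinderEvents_le_pi ?_ ?_ ?_ ?_
  · exact (integrable_const _).indicator (measurableSet_agree _ _)
  · exact fun _ _ _ => ((integrable_const _).indicator (measurableSet_agree _ _)).integrableOn
  · intro A hA _
    have hA' : MeasurableSet A := cylinderEvents_le_pi _ hA
    have h := congrArg ENNReal.toReal (hkey A hA)
    rw [Measure.smul_apply, Measure.restrict_apply hA', Measure.restrict_apply hA', smul_eq_mul,
      ENNReal.toReal_mul, ENNReal.toReal_ofReal hK] at h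
    rw [integral_indicator_const _ (measurableSet_agree _ _),
      integral_indicator_const _ (measurableSet_agree _ _)]
    simp only [smul_eq_mul, mul_one, measureReal_restrict_apply (measurableSet_agree _ _)]
    rw [Set.inter_comm _ A, Set.inter_comm _ A]
    unfold Measure.real
    rw [h, mul_comm]
  · exact (stronglyMeasurable_const.indicator
      (measurableSet_cylinderEvents_agree hbI ζ)).aestronglyMeasurable

end TreeVertex

/-! ### The Gibbs measure with independent increments along the tree -/

lemma exists_isProbabilityMeasure_singleton {ι : Type*} [Fintype ι] [Nonempty ι]
    [MeasurableSpace ι] [MeasurableSingletonClass ι] {f : ι → ℝ} (hf : ∀ i, 0 < f i) :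
    ∃ m : Measure ι, IsProbabilityMeasure m ∧ ∀ i, m {i} = ENNReal.ofReal (f i / ∑ j, f j) := by
  have hpos : 0 < ∑ j, f j := Finset.sum_pos (fun i _ => hf i) Finset.univ_nonempty
  have hsum : ∑ i, ENNReal.ofReal (f i / ∑ j, f j) = 1 := by
    rw [← ENNReal.ofReal_sum_of_nonneg fun i _ => (div_pos (hf i) hpos).le, ← Finset.sum_div,
      div_self hpos.ne', ENNReal.ofReal_one]
  refine ⟨(PMF.ofFintype _ hsum).toMeasure, inferInstance, fun i => ?_⟩
  rw [PMF.toMeasure_apply_singleton _ _ (measurableSet_singleton i), PMF.ofFintype_apply]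

namespace TreeVertex
variable {Δ q : ℕ}

lemma innerEdges_ball (n : ℕ) : innerEdges (ball Δ n) = {v ∈ ball Δ n | v.word ≠ []} := by
  ext v
  simp only [innerEdges, Finset.mem_filter, mem_ball, word_parent, List.length_tail]
  exact ⟨fun h => ⟨h.1, h.2.1⟩, fun h => ⟨h.1, h.2, (Nat.sub_le _ _).trans h.1⟩⟩

variable [NeZero q]

/-- The configuration whose colour at `v` is the sum of the labels on the path from the root
to `v`. -/
def pathSum (ξ : TreeVertex Δ → Fin q) (v : TreeVertex Δ) : Fin q :=
  ∑ k ∈ Finset.range (v.word.length + 1), ξ (parent^[k] v)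

lemma pathSum_root (ξ : TreeVertex Δ → Fin q) {v : TreeVertex Δ} (hv : v.word = []) :
    pathSum ξ v = ξ v := by
  simp [pathSum, hv]

lemma pathSum_of_ne (ξ : TreeVertex Δ → Fin q) {v : TreeVertex Δ} (hv : v.word ≠ []) :
    pathSum ξ v = pathSum ξ (parent v) + ξ v := by
  have hl : v.word.length = (parent v).word.length + 1 := by
    have := List.length_pos_iff.2 hv
    rw [word_parent, List.length_tail]; omega
  rw [pathSum, Finset.sum_range_succ', hl]
  rfl

lemma measurable_pathSum : Measurable (pathSum : (TreeVertex Δ → Fin q) → TreeVertex Δ → Fin q) :=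
  measurable_pi_iff.2 fun _ => Finset.measurable_sum _ fun _ _ => measurable_pi_apply _

/-- The labels that produce the configuration `σ`: its increments along the edges. -/
def increment (σ : TreeVertex Δ → Fin q) (v : TreeVertex Δ) : Fin q :=
  if v.word = [] then σ v else σ v - σ (parent v)

lemma pathSum_preimage_agree (n : ℕ) (σ : TreeVertex Δ → Fin q) :
    pathSum ⁻¹' agree (ball Δ n) σ
      = Set.pi (ball Δ n) fun v => ({increment σ v} : Set (Fin q)) := by
  ext ξ
  simp only [Set.mem_preimage, agree, Set.mem_ofPred_eq, Set.mem_pi, Finset.mem_coe, mem_ball,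
    Set.mem_singleton_iff]
  have hpar : ∀ v : TreeVertex Δ, (parent v).word.length = v.word.length - 1 := fun v => by
    rw [word_parent, List.length_tail]
  constructor
  · intro h v hv
    by_cases h0 : v.word = []
    · rw [increment, if_pos h0, ← h v hv, pathSum_root ξ h0]
    · rw [increment, if_neg h0, ← h v hv, ← h (parent v) (by rw [hpar]; omega),
        pathSum_of_ne ξ h0, add_sub_cancel_left]
  · intro h v hv
    induction hm : v.word.length generalizing v with
    | zero =>
      have h0 := List.length_eq_zero_iff.1 hm
      rw [pathSum_root ξ h0, h v hv, increment, if_pos h0]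
    | succ m ih =>
      have h0 : v.word ≠ [] := fun h => by simp [h] at hm
      rw [pathSum_of_ne ξ h0, h v hv, increment, if_neg h0,
        ih (parent v) (by rw [hpar]; omega) (by rw [hpar]; omega), add_sub_cancel]

/-- Existence of a Gibbs measure: give the root a uniform colour and every other vertex an independent increment with weight
proportional to `w` at `0` and to `1` elsewhere. -/
theorem exists_isPottsGibbs {w : ℝ} (hw : 0 < w) :
    ∃ ν : Measure (TreeVertex Δ → Fin q), IsPottsGibbs (regularTree Δ) q w ν := by
  let g : TreeVertex Δ → Fin q → ℝ := fun v i => if v.word = [] then 1 else edgeWeight w i 0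
  have hg : ∀ v i, 0 < g v i := fun v i => by
    simp only [g]; split_ifs
    exacts [one_pos, edgeWeight_pos hw _ _]
  choose m hm hmg using fun v => exists_isProbabilityMeasure_singleton (hg v)
  have hmr : IsProbabilityMeasure ((Measure.infinitePi m).map pathSum) :=
    Measure.isProbabilityMeasure_map measurable_pathSum.aemeasurable
  refine ⟨(Measure.infinitePi m).map pathSum, isPottsGibbs_of_treeWeight hw fun n =>
    ⟨∏ v ∈ ball Δ n, (∑ j, g v j)⁻¹, fun σ => ?_⟩⟩
  have hgσ : ∀ v, g v (increment σ v)
      = if v.word ≠ [] then edgeWeight w (σ v) (σ (parent v)) else 1 := by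
    intro v
    by_cases h0 : v.word = []
    · simp [g, h0]
    · simp [g, h0, increment, edgeWeight, sub_eq_zero]
  rw [Measure.real, Measure.map_apply measurable_pathSum (measurableSet_agree _ _),
    pathSum_preimage_agree, Measure.infinitePi_pi _ fun _ _ => measurableSet_singleton _,
    ENNReal.toReal_prod, treeWeight, innerEdges_ball, Finset.prod_filter, ← Finset.prod_mul_distrib]
  refine Finset.prod_congr rfl fun v _ => ?_
  rw [hmg, ENNReal.toReal_ofReal
    (div_nonneg (hg v _).le (Finset.sum_nonneg fun j _ => (hg v j).le)), ← hgσ, div_eq_inv_mul]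

end TreeVertex

theorem mainTheorem1 (q : ℕ) (hq : 5 ≤ q) :
    ∃ Δ₀ : ℕ, ∀ Δ : ℕ, Δ₀ ≤ Δ → ∀ w : ℝ, w ∈ Set.Ico (pottsCritical q Δ) 1 →
      ∃! μ : MeasureTheory.Measure (TreeVertex Δ → Fin q),
        IsPottsGibbs (regularTree Δ) q w μ := by
  refine ⟨100000 + 101 * q + 1, fun Δ hΔ w hw => ?_⟩
  obtain ⟨d, rfl⟩ : ∃ d, Δ = d + 1 := ⟨Δ - 1, by omega⟩
  have : NeZero q := ⟨by omega⟩
  have hq0 : (0 : ℝ) < q := by exact_mod_cast (by omega : 0 < q)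
  have hd0 : (0 : ℝ) < (d : ℝ) + 1 := by positivity
  have hqd : (q : ℝ) < (d : ℝ) + 1 := by exact_mod_cast (by omega : q < d + 1)
  have hc : 1 - (q : ℝ) / ((d : ℝ) + 1) ≤ w := by
    have := (le_max_right _ _).trans hw.1
    push_cast at this
    exact this
  have hw0 : 0 < w := lt_of_lt_of_le (sub_pos.2 ((div_lt_one hd0).2 hqd)) hc
  -- the critical parameter enters only through this inequality
  have hθ : (1 - w) / q * ((d : ℝ) + 1) ≤ 1 := by
    have h : 1 - w ≤ q / ((d : ℝ) + 1) := by linarith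
    rw [le_div_iff₀ hd0] at h
    rw [div_mul_eq_mul_div, div_le_one hq0]
    exact h
  obtain ⟨ν, hν⟩ := TreeVertex.exists_isPottsGibbs (Δ := d + 1) (q := q) hw0
  exact ⟨ν, hν, fun μ hμ => TreeVertex.isPottsGibbs_unique hw0 hw.2 hθ (by omega) hμ hν⟩
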